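/- **Lemma (Stochastic Offered Load).** Consider a service system with infinite capacity, job classes $i$ and resource types $n$. Batches of class-$i$ jobs arrive at times $(T_{ik})_{k}$ that form a non-homogeneous Poisson process on $\mathbb{R}$ with locally integrable rate $\lambda_i:\mathbb{R}\to[0,\infty)$, i.e. the number of points in $(a,b]$ is Poisson with mean $\int_a^b\lambda_i(u)\,du$ and the numbers in disjoint intervals are independent ($\lambda_i=0$ on $(-\infty,0)$ if the system starts empty at time $0$). The $k$-th batch contains $V_{ik}\in\{0,1,2,\dots\}$ jobs, all of which start service at $T_{ik}$ and have the same service duration $S_{ik}\ge 0$; its $l$-th job holds an amount $M_{inkl}\ge 0$ of the type-$n$ resource during $[T_{ik},T_{ik}+S_{ik})$. For each $i$ and $n$, the $V_{ik}$ are i.i.d. with finite mean $v_i$ and standard deviation $\beta_i$, the $S_{ik}$ are i.i.d. with distribution $G_i$, the $M_{inkl}$ are i.i.d. over $(k,l)$ with finite mean $r_{in}$ and standard deviation $\delta_{in}$, and the families $(T_{ik})_k$, $(S_{ik})_k$, $(V_{ik})_k$, $(M_{inkl})_{k,l}$ are independent of each other. Put $$m_i(t)=\int_0^\infty\Big(\int_{t-\tau}^{t}\lambda_i(u)\,du\Big)\,dG_i(\tau),\qquad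 B_{ink}=\sum_{l=1}^{V_{ik}}M_{inkl}.$$ Let $N_i(t)$ be the number of class-$i$ batches in service at time $t$, i.e. the number of $k$ with $T_{ik}\le t<T_{ik}+S_{ik}$, and let $X^\infty_{in}(t)$ be the utilization of type-$n$ capacity by class-$i$ jobs at time $t$, i.e. the sum of $M_{inkl}$ over all class-$i$ jobs in service at time $t$. Then, for fixed $i$ and $n$, the batch requirements $(B_{ink})_k$ are i.i.d. and independent of all $(T_{ik},S_{ik})_k$, and for every $t\in\mathbb{R}$ with $m_i(t)<\infty$: 1. almost surely only finitely many class-$i$ batches are in service at time $t$, and $X^\infty_{in}(t)$ is the sum of $B_{ink}$ over these batches; 2. $X^\infty_{in}(t)$ is compound Poisson with time-dependent parameter $m_i(t)$: $N_i(t)$ is Poisson distributed with mean $m_i(t)$, and almost surely $X^\infty_{in}(t)=\sum_{k=1}^{N_i(t)}B'_k$ for random variables $B'_1,B'_2,\dots$ (which may depend on $t$) that are i.i.d. with the distribution of $B_{in1}$ and independent of $N_i(t)$; 3. $X^\infty_{in}(t)$ has a finite second moment, and $$\mathbb{E}[X^\infty_{in}(t)]=v_i r_{in} m_i(t),\qquad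 \operatorname{Var}[X^\infty_{in}(t)]=m_i(t)\big(\delta_{in}^2v_i+r_{in}^2\beta_i^2+v_i^2r_{in}^2\big).$$ -/

import Mathlib

open MeasureTheory ProbabilityTheory Set
open scoped NNReal ENNReal

noncomputable section

/-- Number of points of the sequence `T` that fall in the set `A` of real times. A point whose
value is `⊤` or `⊥` never occurs, so that the total number of points may be finite or infinite. -/
def pointCount {Ω : Type*} (T : ℕ → Ω → EReal) (A : Set ℝ) (ω : Ω) : ℕ∞ :=
  Set.encard {k : ℕ | ∃ u ∈ A, T k ω = (u : EReal)}

/-- The Poisson distribution with mean `r`, as a law on `ℕ∞` that charges only `ℕ`. -/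
def poissonLaw (r : ℝ≥0) : Measure ℕ∞ :=
  (poissonMeasure r).map (Nat.cast : ℕ → ℕ∞)

/-- The points `T k` form a non-homogeneous Poisson process on the real line with rate function
`rate`: the number of points in `(a, b]` is Poisson with mean `∫ u in (a, b], rate u`, and the
numbers of points in consecutive intervals are independent. -/
structure IsNHPoisson {Ω : Type*} [MeasurableSpace Ω] (P : Measure Ω)
    (T : ℕ → Ω → EReal) (rate : ℝ → ℝ≥0) : Prop where
  measurable_point : ∀ k, Measurable (T k)
  count_law : ∀ a b : ℝ, a ≤ b →
    HasLaw (pointCount T (Ioc a b)) (poissonLaw (∫⁻ u in Ioc a b, (rate u : ℝ≥0∞)).toNNReal) P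
  indep_count : ∀ s : ℕ → ℝ, Monotone s →
    iIndepFun (fun j : ℕ => pointCount T (Ioc (s j) (s (j + 1)))) P

/-- The infinite-capacity system with job classes `I` and resource types `R`. Batches of class `i`
are numbered by `k`, jobs in a batch by `l`. The rate functions live on the whole line; a system
that starts empty at time `0` has a rate that vanishes on the negative half-line. -/
structure InfCapSystem {Ω : Type*} [MeasurableSpace Ω] (P : Measure Ω) (I R : Type*) where
  /-- arrival rate of batches of class `i` -/
  rate : I → ℝ → ℝ≥0
  /-- arrival time of the `k`-th batch of class `i` -/
  arrival : I → ℕ → Ω → EReal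
  /-- number of jobs in the `k`-th batch of class `i` -/
  size : I → ℕ → Ω → ℕ
  /-- service duration shared by all jobs in the `k`-th batch of class `i` -/
  service : I → ℕ → Ω → ℝ
  /-- amount of resource `n` required by job `l` of the `k`-th batch of class `i` -/
  req : I → R → ℕ → ℕ → Ω → ℝ
  rate_locInt : ∀ i, LocallyIntegrable (fun u => (rate i u : ℝ)) volume
  arrival_poisson : ∀ i, IsNHPoisson P (arrival i) (rate i)
  size_measurable : ∀ i k, Measurable (size i k)
  service_measurable : ∀ i k, Measurable (service i k)
  req_measurable : ∀ i n k l, Measurable (req i n k l)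
  service_nonneg : ∀ i k, ∀ᵐ ω ∂P, 0 ≤ service i k ω
  req_nonneg : ∀ i n k l, ∀ᵐ ω ∂P, 0 ≤ req i n k l ω
  size_iIndep : ∀ i, iIndepFun (size i) P
  size_ident : ∀ i k, IdentDistrib (size i k) (size i 0) P P
  service_iIndep : ∀ i, iIndepFun (service i) P
  service_ident : ∀ i k, IdentDistrib (service i k) (service i 0) P P
  req_iIndep : ∀ i n, iIndepFun (fun kl : ℕ × ℕ => req i n kl.1 kl.2) P
  req_ident : ∀ i n k l, IdentDistrib (req i n k l) (req i n 0 0) P P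
  size_memLp : ∀ i, MemLp (fun ω => (size i 0 ω : ℝ)) 2 P
  req_memLp : ∀ i n, MemLp (req i n 0 0) 2 P
  /- For each class and resource, the arrival times, the service durations, the batch sizes and the
  requirements are mutually independent. -/
  arrival_indep : ∀ i n, IndepFun (fun ω k => arrival i k ω)
    (fun ω => ((fun k => service i k ω), (fun k => size i k ω), fun k l => req i n k l ω)) P
  service_indep : ∀ i n, IndepFun (fun ω k => service i k ω)
    (fun ω => ((fun k => size i k ω), fun k l => req i n k l ω)) P
  size_indep : ∀ i n, IndepFun (fun ω k => size i k ω) (fun ω k l => req i n k l ω) P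

namespace InfCapSystem

variable {Ω : Type*} [MeasurableSpace Ω] {P : Measure Ω} {I R : Type*}

/-- The `k`-th batch of class `i` is in service at time `t`: there is no waiting. -/
def InService (Q : InfCapSystem P I R) (i : I) (t : ℝ) (k : ℕ) (ω : Ω) : Prop :=
  Q.arrival i k ω ≤ (t : EReal) ∧ (t : EReal) < Q.arrival i k ω + (Q.service i k ω : EReal)

/-- Number of batches of class `i` in service at time `t`; this is the number of busy servers
of the `M_t/G/∞` queue fed by the batch arrivals. -/
def busy (Q : InfCapSystem P I R) (i : I) (t : ℝ) (ω : Ω) : ℕ∞ :=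
  Set.encard {k : ℕ | Q.InService i t k ω}

/-- Total amount of resource `n` required by the jobs of the `k`-th batch of class `i`. -/
def batchReq (Q : InfCapSystem P I R) (i : I) (n : R) (k : ℕ) (ω : Ω) : ℝ :=
  ∑ l ∈ Finset.range (Q.size i k ω), Q.req i n k l ω

open Classical in
/-- Utilization of resource `n` at time `t`: the total requirement of all class-`i` jobs that are
in service at time `t`. -/
def utilization (Q : InfCapSystem P I R) (i : I) (n : R) (t : ℝ) (ω : Ω) : ℝ :=
  ∑' k : ℕ, if Q.InService i t k ω then
    ∑ l ∈ Finset.range (Q.size i k ω), Q.req i n k l ω else 0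

/-- The distribution `G_i` of the service duration. -/
def serviceLaw (Q : InfCapSystem P I R) (i : I) : Measure ℝ := P.map (Q.service i 0)

/-- The mean `m_i(t) = ∫_0^∞ (∫_{t-τ}^t λ_i(u) du) dG_i(τ)` of the `M_t/G/∞` queue. -/
def offeredMean (Q : InfCapSystem P I R) (i : I) (t : ℝ) : ℝ≥0∞ :=
  ∫⁻ τ in Ioi (0 : ℝ), (∫⁻ u in Ioc (t - τ) t, (Q.rate i u : ℝ≥0∞)) ∂(Q.serviceLaw i)

/-- Mean batch size. -/
def sizeMean (Q : InfCapSystem P I R) (i : I) : ℝ := ∫ ω, (Q.size i 0 ω : ℝ) ∂P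

/-- Standard deviation of the batch size. -/
def sizeSD (Q : InfCapSystem P I R) (i : I) : ℝ :=
  Real.sqrt (variance (fun ω => (Q.size i 0 ω : ℝ)) P)

/-- Mean requirement of resource `n` by a class-`i` job. -/
def reqMean (Q : InfCapSystem P I R) (i : I) (n : R) : ℝ := ∫ ω, Q.req i n 0 0 ω ∂P

/-- Standard deviation of the requirement of resource `n` by a class-`i` job. -/
def reqSD (Q : InfCapSystem P I R) (i : I) (n : R) : ℝ :=
  Real.sqrt (variance (Q.req i n 0 0) P)

end InfCapSystem

/-- `X` is a compound Poisson sum with count `N`, Poisson parameter `m` and summand law `μ`: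
`X = ∑_{k < N} B k` almost surely, where `N` is Poisson with mean `m` and `B 0, B 1, …` are i.i.d.
with law `μ` and independent of `N`. -/
def IsCompoundPoisson {Ω : Type*} [MeasurableSpace Ω] (P : Measure Ω)
    (N : Ω → ℕ∞) (X : Ω → ℝ) (m : ℝ≥0) (μ : Measure ℝ) : Prop :=
  HasLaw N (poissonLaw m) P ∧
  ∃ B : ℕ → Ω → ℝ, iIndepFun B P ∧ (∀ k, HasLaw (B k) μ P) ∧
    IndepFun N (fun ω k => B k ω) P ∧
    ∀ᵐ ω ∂P, X ω = ∑ k ∈ Finset.range (N ω).toNat, B k ω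

end

/-! A batch is in service at `t` exactly when `t - S k < T k ≤ t`, so `busy` counts the points of a
Poisson process whose independent i.i.d. marks pass a test that depends on their position. Only the
counts in intervals are known to be Poisson and independent, so time is cut into cells `(s j, s
(j+1)]`, and in each cell the test is replaced by the stricter `t - s j < S k`, whose threshold is
constant on the cell. With the arrivals frozen, each point of cell `j` then survives independently
with probability `p j`. Averaging over the counts gives the generating function `exp ((∑ Λ j * p j)
* (z - 1))`, a Poisson law (`integral_pow_encard_gridSet`, `measure_encard_gridSet_eq`). As the mesh
shrinks and the window grows, the kept sets exhaust the set in service, and the parameters converge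
to `m_i(t)` by dominated convergence (`tendsto_sum_grid`, `hasLaw_encard_marked_points`).

The set of batches in service is a function of arrivals and durations, hence independent of the
batch requirements. Listing the requirements with this random set first therefore gives again an
i.i.d. sequence independent of the set (`indepFun_randomInjection`), and the utilization is the sum
of its first `N` terms. The moments come from the Wald identities (`memLp_and_moments_random_sum`),
used once inside a batch and once over the batches in service, where the count has mean and variance
`m_i(t)`. -/

/-! ### Independence of pairs and of randomly relabelled sequences -/

section Independence

variable {Ω : Type*} [MeasurableSpace Ω] {P : Measure Ω}

lemma measurableSet_forall_mem_finset {ι γ : Type*} [MeasurableSpace γ] (S : Finset ι)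
    {C : ι → Set γ} (hC : ∀ i, MeasurableSet (C i)) :
    MeasurableSet {x : ι → γ | ∀ i ∈ S, x i ∈ C i} := by
  have : {x : ι → γ | ∀ i ∈ S, x i ∈ C i} = ⋂ i ∈ S, (fun x => x i) ⁻¹' C i := by
    ext; simp
  rw [this]
  exact S.measurableSet_biInter fun i _ => measurable_pi_apply i (hC i)

/-- Rectangles generate the product σ-algebra and form a π-system; on them a finite intersection
separates into an event of `X` and an event of `Y`, each of which factorises. -/
lemma iIndepFun_prodMk {ι α β : Type*} [MeasurableSpace α] [MeasurableSpace β]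
    {X : ι → Ω → α} {Y : ι → Ω → β} (hXm : ∀ i, Measurable (X i)) (hYm : ∀ i, Measurable (Y i))
    (hX : iIndepFun X P) (hY : iIndepFun Y P)
    (hXY : IndepFun (fun ω i => X i ω) (fun ω i => Y i ω) P) :
    iIndepFun (fun i ω => (X i ω, Y i ω)) P := by
  rw [iIndepFun_iff_iIndep]
  refine iIndepSets.iIndep (fun i => ((hXm i).prodMk (hYm i)).comap_le)
    (fun i => preimage (fun ω => (X i ω, Y i ω)) ''
      image2 (· ×ˢ ·) {s | MeasurableSet s} {t | MeasurableSet t})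
    (fun i => isPiSystem_prod.comap _)
    (fun i => by rw [← MeasurableSpace.comap_generateFrom, generateFrom_prod]) ?_
  rw [iIndepSets_iff]
  intro S f hf
  -- The index set `S` is finite but the sides are chosen for every `i`; outside `S` the empty sets
  -- are mere placeholders.
  have key : ∀ i, ∃ A : Set α, ∃ B : Set β, MeasurableSet A ∧ MeasurableSet B ∧
      (i ∈ S → f i = X i ⁻¹' A ∩ Y i ⁻¹' B) := by
    intro i
    by_cases hi : i ∈ S
    · obtain ⟨_, ⟨A, hA, B, hB, rfl⟩, h⟩ := hf i hi
      exact ⟨A, B, hA, hB, fun _ => h.symm⟩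
    · exact ⟨∅, ∅, .empty, .empty, fun h => absurd h hi⟩
  choose A B hA hB hf' using key
  have h1 : (⋂ i ∈ S, f i) = (fun ω i => X i ω) ⁻¹' {x | ∀ i ∈ S, x i ∈ A i} ∩
      (fun ω i => Y i ω) ⁻¹' {x | ∀ i ∈ S, x i ∈ B i} := by
    ext ω
    simp only [mem_iInter, mem_inter_iff, mem_preimage, mem_ofPred_eq]
    constructor
    · intro h
      exact ⟨fun i hi => ((hf' i hi) ▸ h i hi).1, fun i hi => ((hf' i hi) ▸ h i hi).2⟩
    · intro h i hi
      rw [hf' i hi]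
      exact ⟨h.1 i hi, h.2 i hi⟩
  have h2 : (fun ω i => X i ω) ⁻¹' {x | ∀ i ∈ S, x i ∈ A i} = ⋂ i ∈ S, X i ⁻¹' A i := by
    ext; simp
  have h3 : (fun ω i => Y i ω) ⁻¹' {x | ∀ i ∈ S, x i ∈ B i} = ⋂ i ∈ S, Y i ⁻¹' B i := by
    ext; simp
  rw [h1, hXY.measure_inter_preimage_eq_mul _ _ (measurableSet_forall_mem_finset S hA)
      (measurableSet_forall_mem_finset S hB), h2, h3,
    hX.measure_inter_preimage_eq_mul S fun i _ => hA i,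
    hY.measure_inter_preimage_eq_mul S fun i _ => hB i, ← Finset.prod_mul_distrib]
  refine Finset.prod_congr rfl fun i hi => ?_
  rw [hf' i hi]
  exact ((hXY.comp (measurable_pi_apply i) (measurable_pi_apply i)).measure_inter_preimage_eq_mul
    _ _ (hA i) (hB i)).symm

/-- The joint law is `μX ⊗ (μY ⊗ μZ)`, and reassociating the product moves the bracket. -/
lemma ProbabilityTheory.IndepFun.prodMk_left_of_right {α β γ : Type*} [MeasurableSpace α] [MeasurableSpace β]
    [MeasurableSpace γ] [IsProbabilityMeasure P] {X : Ω → α} {Y : Ω → β} {Z : Ω → γ}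
    (hX : Measurable X) (hY : Measurable Y) (hZ : Measurable Z)
    (h : IndepFun X (fun ω => (Y ω, Z ω)) P) (h' : IndepFun Y Z P) :
    IndepFun (fun ω => (X ω, Y ω)) Z P := by
  have hXY : IndepFun X Y P := h.comp measurable_id measurable_fst
  have := Measure.isProbabilityMeasure_map (μ := P) hX.aemeasurable
  have := Measure.isProbabilityMeasure_map (μ := P) hY.aemeasurable
  have := Measure.isProbabilityMeasure_map (μ := P) hZ.aemeasurable
  rw [indepFun_iff_map_prod_eq_prod_map_map (by fun_prop) (by fun_prop)] at h h' hXY ⊢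
  rw [h'] at h
  rw [hXY]
  have e : P.map (fun ω => ((X ω, Y ω), Z ω)) =
      (P.map fun ω => (X ω, Y ω, Z ω)).map MeasurableEquiv.prodAssoc.symm := by
    rw [Measure.map_map (by fun_prop) (by fun_prop)]
    rfl
  rw [e, h, ← Measure.prodAssoc_prod, Measure.map_map (by fun_prop) (by fun_prop)]
  simp

/-- Relabelling an i.i.d. sequence by an independent random injection neither changes its law nor
makes it depend on the label. -/
lemma indepFun_randomInjection {ι β : Type*} [MeasurableSpace ι] [Countable ι]
    [DiscreteMeasurableSpace ι] [MeasurableSpace β] [IsProbabilityMeasure P]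
    {F : Ω → ι} {B : ℕ → Ω → β} {κ : ι → ℕ → ℕ} (hκ : ∀ a, Function.Injective (κ a))
    (hF : Measurable F) (hB : ∀ k, Measurable (B k)) (hiB : iIndepFun B P)
    (hid : ∀ k, IdentDistrib (B k) (B 0) P P) (h : IndepFun F (fun ω k => B k ω) P) :
    Measurable (fun ω k => B (κ (F ω) k) ω) ∧ iIndepFun (fun k ω => B (κ (F ω) k) ω) P ∧
      (∀ k, HasLaw (fun ω => B (κ (F ω) k) ω) (P.map (B 0)) P) ∧
      IndepFun F (fun ω k => B (κ (F ω) k) ω) P := by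
  have hμ : IsProbabilityMeasure (P.map (B 0)) := Measure.isProbabilityMeasure_map (hB 0).aemeasurable
  set ν := Measure.infinitePi (fun _ : ℕ => P.map (B 0)) with hν
  have hBm : Measurable (fun ω k => B k ω) := measurable_pi_iff.2 hB
  have hlawB : P.map (fun ω k => B k ω) = ν := by
    rw [hiB.map_fun_eq_infinitePi_map hB]
    congr 1
    funext k
    exact (hid k).map_eq
  have hΦ : Measurable (fun p : ι × (ℕ → β) => (p.1, fun k => p.2 (κ p.1 k))) := by
    refine measurable_from_prod_countable_right fun a => ?_
    exact measurable_const.prodMk (measurable_pi_iff.2 fun k => measurable_pi_apply (κ a k))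
  have hB' : Measurable (fun ω k => B (κ (F ω) k) ω) :=
    measurable_snd.comp (hΦ.comp (hF.prodMk hBm))
  have hPF := Measure.isProbabilityMeasure_map (μ := P) hF.aemeasurable
  have joint : P.map (fun ω => (F ω, fun k => B (κ (F ω) k) ω)) = (P.map F).prod ν := by
    have e : P.map (fun ω => (F ω, fun k => B (κ (F ω) k) ω)) =
        (P.map (fun ω => (F ω, fun k => B k ω))).map
          (fun p : ι × (ℕ → β) => (p.1, fun k => p.2 (κ p.1 k))) := by
      rw [Measure.map_map hΦ (by fun_prop)]
      rfl
    rw [e, (indepFun_iff_map_prod_eq_prod_map_map (by fun_prop) (by fun_prop)).1 h, hlawB]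
    symm
    refine Measure.prod_eq fun s t hs ht => ?_
    rw [Measure.map_apply hΦ (hs.prod ht), Measure.prod_apply (hΦ (hs.prod ht))]
    -- With the label frozen at `a`, precomposition with the injection `κ a` preserves the product
    -- law `ν`, so the slice depends on `a` only through `a ∈ s`.
    have : ∀ a, ν (Prod.mk a ⁻¹' ((fun p : ι × (ℕ → β) => (p.1, fun k => p.2 (κ p.1 k))) ⁻¹'
        (s ×ˢ t))) = s.indicator (fun _ => ν t) a := by
      intro a
      by_cases ha : a ∈ s
      · rw [indicator_of_mem ha]
        have hm := Measure.map_infinitePi_infinitePi_of_inj (P := fun _ : ℕ => P.map (B 0)) (hκ a)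
        rw [← hν] at hm
        conv_rhs => rw [← hm, Measure.map_apply (by fun_prop) ht]
        congr 1
        ext x
        simp [ha]
      · rw [indicator_of_notMem ha]
        convert measure_empty (μ := ν)
        ext x
        simp [ha]
    simp_rw [this]
    rw [lintegral_indicator hs, lintegral_const, Measure.restrict_apply_univ, mul_comm]
  have hlaw : P.map (fun ω k => B (κ (F ω) k) ω) = ν := by
    have := congrArg (Measure.map Prod.snd) joint
    rw [Measure.map_map measurable_snd (hF.prodMk hB'), Measure.map_snd_prod, measure_univ,
      one_smul] at this
    exact this
  have hcoord : ∀ k, P.map (fun ω => B (κ (F ω) k) ω) = P.map (B 0) := by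
    intro k
    have := congrArg (Measure.map (fun x : ℕ → β => x k)) hlaw
    rw [Measure.map_map (by fun_prop) hB', hν,
      Measure.infinitePi_map_eval (fun _ : ℕ => P.map (B 0)) k] at this
    exact this
  refine ⟨hB', ?_, fun k => ⟨(measurable_pi_iff.1 hB' k).aemeasurable, hcoord k⟩, ?_⟩
  · rw [iIndepFun_iff_map_fun_eq_infinitePi_map (measurable_pi_iff.1 hB'), hlaw, hν]
    congr 1
    funext k
    exact (hcoord k).symm
  · rw [indepFun_iff_map_prod_eq_prod_map_map hF.aemeasurable hB'.aemeasurable, joint, hlaw]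

end Independence

/-! ### Wald identities -/

section RandomSums

variable {Ω : Type*} [MeasurableSpace Ω] {P : Measure Ω} [IsProbabilityMeasure P]

lemma integral_sum_range_of_identDistrib {Y : ℕ → Ω → ℝ}
    (hid : ∀ k, IdentDistrib (Y k) (Y 0) P P) (hY : MemLp (Y 0) 2 P) (n : ℕ) :
    ∫ ω, ∑ k ∈ Finset.range n, Y k ω ∂P = n * ∫ ω, Y 0 ω ∂P := by
  rw [integral_finsetSum _ fun k _ => ((hid k).memLp_iff.2 hY).integrable one_le_two,
    Finset.sum_congr rfl fun k _ => (hid k).integral_eq]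
  simp

lemma integral_sq_sum_range_of_iIndepFun {Y : ℕ → Ω → ℝ} (hi : iIndepFun Y P)
    (hid : ∀ k, IdentDistrib (Y k) (Y 0) P P) (hY : MemLp (Y 0) 2 P) (n : ℕ) :
    ∫ ω, (∑ k ∈ Finset.range n, Y k ω) ^ 2 ∂P =
      n * variance (Y 0) P + (n : ℝ) ^ 2 * (∫ ω, Y 0 ω ∂P) ^ 2 := by
  have hYk : ∀ k, MemLp (Y k) 2 P := fun k => (hid k).memLp_iff.2 hY
  have hS : MemLp (∑ k ∈ Finset.range n, Y k) 2 P := memLp_finsetSum' _ fun k _ => hYk k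
  have hv : variance (∑ k ∈ Finset.range n, Y k) P = n * variance (Y 0) P := by
    rw [IndepFun.variance_sum (fun k _ => hYk k)
      (fun i _ j _ hij => hi.indepFun hij), Finset.sum_congr rfl fun k _ => (hid k).variance_eq]
    simp
  have hm := integral_sum_range_of_identDistrib hid hY n
  rw [variance_eq_sub hS] at hv
  simp only [Pi.pow_apply, Finset.sum_apply] at hv
  rw [hm] at hv
  linarith

variable {N : Ω → ℕ} {Y : ℕ → Ω → ℝ}

lemma measurable_sum_range_prod :
    Measurable (fun p : ℕ × (ℕ → ℝ) => ∑ k ∈ Finset.range p.1, p.2 k) := by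
  refine measurable_from_prod_countable_right fun n => ?_
  exact Finset.measurable_sum (Finset.range n) fun k _ => measurable_pi_apply (X := fun _ : ℕ => ℝ) k

/-- The second-order Wald identities: a random sum of i.i.d. square integrable terms whose number
of terms is square integrable and independent of the terms. -/
lemma memLp_and_moments_random_sum (hN : Measurable N) (hYm : ∀ k, Measurable (Y k))
    (hi : iIndepFun Y P) (hid : ∀ k, IdentDistrib (Y k) (Y 0) P P) (hY : MemLp (Y 0) 2 P)
    (hind : IndepFun N (fun ω k => Y k ω) P) (hN2 : MemLp (fun ω => (N ω : ℝ)) 2 P) :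
    MemLp (fun ω => ∑ k ∈ Finset.range (N ω), Y k ω) 2 P ∧
    ∫ ω, ∑ k ∈ Finset.range (N ω), Y k ω ∂P = (∫ ω, (N ω : ℝ) ∂P) * ∫ ω, Y 0 ω ∂P ∧
    variance (fun ω => ∑ k ∈ Finset.range (N ω), Y k ω) P =
      (∫ ω, (N ω : ℝ) ∂P) * variance (Y 0) P +
        variance (fun ω => (N ω : ℝ)) P * (∫ ω, Y 0 ω ∂P) ^ 2 := by
  have hYs : Measurable (fun ω k => Y k ω) := measurable_pi_iff.2 hYm
  have hPN := Measure.isProbabilityMeasure_map (μ := P) hN.aemeasurable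
  have hPY := Measure.isProbabilityMeasure_map (μ := P) hYs.aemeasurable
  have hYk : ∀ k, MemLp (Y k) 2 P := fun k => (hid k).memLp_iff.2 hY
  set g : ℕ × (ℕ → ℝ) → ℝ := fun p => ∑ k ∈ Finset.range p.1, p.2 k with hg
  have hgm : Measurable g := measurable_sum_range_prod
  have hgn : ∀ n, Measurable (fun y : ℕ → ℝ => g (n, y)) := fun n =>
    hgm.comp measurable_prodMk_left
  have hlaw := (indepFun_iff_map_prod_eq_prod_map_map hN.aemeasurable hYs.aemeasurable).1 hind
  have hpair : Measurable fun ω => (N ω, fun k => Y k ω) := hN.prodMk hYs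
  have hSn : ∀ n, MemLp (fun ω => ∑ k ∈ Finset.range n, Y k ω) 2 P :=
    fun n => memLp_finsetSum _ fun k _ => hYk k
  have h2 : ∀ n : ℕ, ∫ y, g (n, y) ^ 2 ∂(P.map fun ω k => Y k ω) =
      n * variance (Y 0) P + (n : ℝ) ^ 2 * (∫ ω, Y 0 ω ∂P) ^ 2 := by
    intro n
    rw [integral_map hYs.aemeasurable ((hgn n).pow_const 2).aestronglyMeasurable]
    exact integral_sq_sum_range_of_iIndepFun hi hid hY n
  have h1 : ∀ n : ℕ, ∫ y, g (n, y) ∂(P.map fun ω k => Y k ω) = n * ∫ ω, Y 0 ω ∂P := by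
    intro n
    rw [integral_map hYs.aemeasurable (hgn n).aestronglyMeasurable]
    exact integral_sum_range_of_identDistrib hid hY n
  have hNi : Integrable (fun ω => (N ω : ℝ)) P := hN2.integrable one_le_two
  have hNsq : Integrable (fun ω => (N ω : ℝ) ^ 2) P := hN2.integrable_sq
  have hint2 : Integrable (fun n : ℕ =>
      n * variance (Y 0) P + (n : ℝ) ^ 2 * (∫ ω, Y 0 ω ∂P) ^ 2) (P.map N) := by
    rw [integrable_map_measure .of_discrete hN.aemeasurable]
    exact (hNi.mul_const _).add (hNsq.mul_const _)
  -- For a fixed number `n` of terms the second moment is quadratic in `n`, so integrability of `N ^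
  -- 2` is what makes Fubini applicable.
  have hsq : Integrable (fun p => g p ^ 2) ((P.map N).prod (P.map fun ω k => Y k ω)) := by
    rw [integrable_prod_iff (hgm.pow_const 2).aestronglyMeasurable]
    refine ⟨ae_of_all _ fun n => ?_, ?_⟩
    · rw [integrable_map_measure ((hgn n).pow_const 2).aestronglyMeasurable hYs.aemeasurable]
      exact (hSn n).integrable_sq
    · refine hint2.congr (ae_of_all _ fun n => ?_)
      simp only [norm_pow, Real.norm_eq_abs, sq_abs]
      exact (h2 n).symm
  have hgL : MemLp g 2 ((P.map N).prod (P.map fun ω k => Y k ω)) :=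
    (memLp_two_iff_integrable_sq hgm.aestronglyMeasurable).2 hsq
  have hL : MemLp (fun ω => ∑ k ∈ Finset.range (N ω), Y k ω) 2 P := by
    rw [← hlaw, memLp_map_measure_iff hgm.aestronglyMeasurable hpair.aemeasurable] at hgL
    exact hgL
  have hE1 : ∫ ω, ∑ k ∈ Finset.range (N ω), Y k ω ∂P = (∫ ω, (N ω : ℝ) ∂P) * ∫ ω, Y 0 ω ∂P := by
    calc ∫ ω, ∑ k ∈ Finset.range (N ω), Y k ω ∂P
        = ∫ p, g p ∂((P.map N).prod (P.map fun ω k => Y k ω)) := by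
          rw [← hlaw, integral_map hpair.aemeasurable hgm.aestronglyMeasurable]
      _ = _ := by
          rw [integral_prod _ (hgL.integrable one_le_two)]
          simp_rw [h1]
          rw [integral_map hN.aemeasurable .of_discrete, integral_mul_const]
  have hE2 : ∫ ω, (∑ k ∈ Finset.range (N ω), Y k ω) ^ 2 ∂P =
      (∫ ω, (N ω : ℝ) ∂P) * variance (Y 0) P +
        (∫ ω, (N ω : ℝ) ^ 2 ∂P) * (∫ ω, Y 0 ω ∂P) ^ 2 := by
    calc ∫ ω, (∑ k ∈ Finset.range (N ω), Y k ω) ^ 2 ∂P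
        = ∫ p, g p ^ 2 ∂((P.map N).prod (P.map fun ω k => Y k ω)) := by
          rw [← hlaw, integral_map hpair.aemeasurable (hgm.pow_const 2).aestronglyMeasurable]
      _ = _ := by
          rw [integral_prod _ hsq]
          simp_rw [h2]
          rw [integral_map hN.aemeasurable .of_discrete,
            integral_add (hNi.mul_const _) (hNsq.mul_const _), integral_mul_const,
            integral_mul_const]
  refine ⟨hL, hE1, ?_⟩
  rw [variance_eq_sub hL, variance_eq_sub hN2]
  simp only [Pi.pow_apply]
  rw [hE1, hE2]
  ring

end RandomSums

/-! ### Moments of the Poisson law -/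

section PoissonMoments

open Real Nat in
-- The falling factorial cancels the top `j` factors of `n!`; after a shift of the index by `j` the
-- series is `r ^ j` times the total Poisson mass.
lemma hasSum_poisson_descFactorial (r : ℝ≥0) (j : ℕ) :
    HasSum (fun n : ℕ => exp (-r) * r ^ n / (n)! * (n.descFactorial j : ℝ)) ((r : ℝ) ^ j) := by
  rw [← hasSum_nat_add_iff' j]
  have h0 : ∑ n ∈ Finset.range j, exp (-r) * r ^ n / (n)! * (n.descFactorial j : ℝ) = 0 := by
    refine Finset.sum_eq_zero fun n hn => ?_
    rw [Nat.descFactorial_of_lt (Finset.mem_range.1 hn)]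
    simp
  rw [h0, sub_zero]
  have h := (hasSum_one_poissonMeasure r).mul_left ((r : ℝ) ^ j)
  rw [mul_one] at h
  refine h.congr_fun ?_
  intro n
  have hd : ((n + j)! : ℝ) = (n)! * ((n + j).descFactorial j : ℝ) := by
    have := Nat.factorial_mul_descFactorial (Nat.le_add_left j n)
    rw [Nat.add_sub_cancel] at this
    exact_mod_cast this.symm
  have h1 : ((n)! : ℝ) ≠ 0 := by positivity
  have h2 : ((n + j).descFactorial j : ℝ) ≠ 0 := by
    have := Nat.descFactorial_eq_zero_iff_lt (n := n + j) (k := j)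
    norm_cast
    omega
  rw [hd]
  field_simp
  ring

lemma integral_sq_poissonMeasure (r : ℝ≥0) :
    Integrable (fun n : ℕ => (n : ℝ) ^ 2) (poissonMeasure r) ∧
      ∫ n, (n : ℝ) ^ 2 ∂(poissonMeasure r) = r ^ 2 + r := by
  -- The identity used is `n ^ 2 = n * (n - 1) + n`.
  have h := (hasSum_poisson_descFactorial r 2).add (hasSum_poisson_descFactorial r 1)
  rw [pow_one] at h
  have e : ∀ n : ℕ, ((n.descFactorial 2 : ℕ) : ℝ) + (n.descFactorial 1 : ℕ) = (n : ℝ) ^ 2 := by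
    intro n
    rcases n with _ | n
    · simp
    · simp [Nat.descFactorial_succ]
      ring
  simp_rw [← mul_add, e] at h
  constructor
  · rw [integrable_poissonMeasure_iff]
    simpa using h.summable
  · rw [integral_poissonMeasure]
    simpa using h.tsum_eq

lemma integral_id_poissonMeasure (r : ℝ≥0) : ∫ n, (n : ℝ) ∂(poissonMeasure r) = r := by
  rw [integral_poissonMeasure]
  simpa using (hasSum_poisson_descFactorial r 1).tsum_eq

variable {Ω : Type*} [MeasurableSpace Ω] {P : Measure Ω}

lemma ProbabilityTheory.HasLaw.toNat_poissonLaw {N : Ω → ℕ∞} {r : ℝ≥0} (h : HasLaw N (poissonLaw r) P) :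
    HasLaw (fun ω => (N ω).toNat) (poissonMeasure r) P := by
  refine ⟨Measurable.of_discrete.comp_aemeasurable h.aemeasurable, ?_⟩
  have := congrArg (Measure.map ENat.toNat) h.map_eq
  rw [AEMeasurable.map_map_of_aemeasurable Measurable.of_discrete.aemeasurable h.aemeasurable,
    poissonLaw, Measure.map_map .of_discrete .of_discrete] at this
  refine this.trans ?_
  rw [show (ENat.toNat ∘ Nat.cast : ℕ → ℕ) = id from funext ENat.toNat_natCast, Measure.map_id]

lemma ProbabilityTheory.HasLaw.poisson_moments [IsProbabilityMeasure P] {N : Ω → ℕ} {r : ℝ≥0} (h : HasLaw N (poissonMeasure r) P) :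
    MemLp (fun ω => (N ω : ℝ)) 2 P ∧ ∫ ω, (N ω : ℝ) ∂P = r ∧
      variance (fun ω => (N ω : ℝ)) P = r := by
  have hm : AEMeasurable (fun ω => (N ω : ℝ)) P :=
    (Measurable.of_discrete (f := fun n : ℕ => (n : ℝ))).comp_aemeasurable h.aemeasurable
  have hL : MemLp (fun ω => (N ω : ℝ)) 2 P := by
    rw [memLp_two_iff_integrable_sq hm.aestronglyMeasurable]
    have := (integral_sq_poissonMeasure r).1
    rw [← h.map_eq, integrable_map_measure .of_discrete h.aemeasurable] at this
    exact this
  have h1 : ∫ ω, (N ω : ℝ) ∂P = r := by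
    rw [← integral_id_poissonMeasure r, ← h.map_eq, integral_map h.aemeasurable .of_discrete]
  have h2 : ∫ ω, (N ω : ℝ) ^ 2 ∂P = r ^ 2 + r := by
    rw [← (integral_sq_poissonMeasure r).2, ← h.map_eq, integral_map h.aemeasurable .of_discrete]
  refine ⟨hL, h1, ?_⟩
  rw [variance_eq_sub hL]
  simp only [Pi.pow_apply]
  rw [h1, h2]
  ring

end PoissonMoments

/-! ### Thinning a Poisson process cell by cell -/

section MarkedPoints

variable {Ω : Type*} [MeasurableSpace Ω] {P : Measure Ω}

/-- Fubini on the product law, in the role of conditioning on `X`; boundedness provides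
integrability. -/
lemma ProbabilityTheory.IndepFun.integral_comp_prodMk [IsProbabilityMeasure P] {α β : Type*} [MeasurableSpace α] [MeasurableSpace β]
    {X : Ω → α} {Y : Ω → β} (hX : Measurable X) (hY : Measurable Y) (h : IndepFun X Y P)
    {f : α × β → ℂ} (hf : Measurable f) {C : ℝ} (hC : ∀ p, ‖f p‖ ≤ C) :
    ∫ ω, f (X ω, Y ω) ∂P = ∫ ω, ∫ ω', f (X ω, Y ω') ∂P ∂P := by
  have := Measure.isProbabilityMeasure_map (μ := P) hX.aemeasurable
  have := Measure.isProbabilityMeasure_map (μ := P) hY.aemeasurable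
  have hfs := hf.stronglyMeasurable
  calc ∫ ω, f (X ω, Y ω) ∂P = ∫ p, f p ∂(P.map X).prod (P.map Y) := by
        rw [← (indepFun_iff_map_prod_eq_prod_map_map hX.aemeasurable hY.aemeasurable).1 h,
          integral_map (hX.prodMk hY).aemeasurable hfs.aestronglyMeasurable]
    _ = ∫ x, ∫ y, f (x, y) ∂(P.map Y) ∂(P.map X) :=
        integral_prod _ (Integrable.of_bound hfs.aestronglyMeasurable C (ae_of_all _ hC))
    _ = ∫ ω, ∫ y, f (X ω, y) ∂(P.map Y) ∂P :=
        integral_map hX.aemeasurable (StronglyMeasurable.integral_prod_right (f := fun x y => f (x, y)) hfs).aestronglyMeasurable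
    _ = _ := by
        refine integral_congr_ae (ae_of_all _ fun ω => ?_)
        exact integral_map hY.aemeasurable
          (hf.comp measurable_prodMk_left).stronglyMeasurable.aestronglyMeasurable

/-- The blocks `K j` are disjoint, so no `S k` occurs twice and the double product runs over a
subfamily of independent variables. -/
lemma ProbabilityTheory.iIndepFun.integral_prod_prod {ι : Type*} {S : ℕ → Ω → ℝ} (hSm : ∀ k, Measurable (S k))
    (hS : iIndepFun S P) (J : Finset ι) (K : ι → Finset ℕ)
    (hK : ∀ i ∈ J, ∀ j ∈ J, ∀ k, k ∈ K i → k ∈ K j → i = j) {φ : ι → ℝ → ℂ}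
    (hφ : ∀ j, Measurable (φ j)) :
    ∫ ω, ∏ j ∈ J, ∏ k ∈ K j, φ j (S k ω) ∂P = ∏ j ∈ J, ∏ k ∈ K j, ∫ ω, φ j (S k ω) ∂P := by
  have hinj : Function.Injective (fun p : J.sigma K => p.1.2) := by
    rintro ⟨⟨i, k⟩, hi⟩ ⟨⟨j, l⟩, hj⟩ h
    simp only [Finset.mem_sigma] at hi hj h
    subst h
    obtain rfl := hK i hi.1 j hj.1 k hi.2 hj.2
    rfl
  have hc (F : ι → ℕ → ℂ) : ∏ j ∈ J, ∏ k ∈ K j, F j k = ∏ p : J.sigma K, F p.1.1 p.1.2 := by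
    rw [Finset.prod_sigma', ← Finset.prod_coe_sort]
  rw [hc (fun j k => ∫ ω, φ j (S k ω) ∂P)]
  simp_rw [hc]
  exact (hS.precomp hinj).integral_fun_prod_comp
    (f := fun p : J.sigma K => φ p.1.1) (fun p => (hSm _).aemeasurable)
    (fun p => (hφ _).stronglyMeasurable.aestronglyMeasurable)

lemma exists_mem_Ioc_coe_iff {a b : ℝ} {x : EReal} :
    (∃ u ∈ Ioc a b, x = (u : EReal)) ↔ (a : EReal) < x ∧ x ≤ b := by
  constructor
  · rintro ⟨u, ⟨h1, h2⟩, rfl⟩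
    exact ⟨EReal.coe_lt_coe h1, EReal.coe_le_coe h2⟩
  · rintro ⟨h1, h2⟩
    induction x with
    | bot => simp at h1
    | top => simp at h2
    | coe u => exact ⟨u, ⟨EReal.coe_lt_coe_iff.1 h1, EReal.coe_le_coe_iff.1 h2⟩, rfl⟩

/-- The points `x k` in one of the cells `(s j, s (j + 1)]`, `j < J`, whose mark reaches from the
left end of the cell beyond `t`. -/
def gridSet (s : ℕ → ℝ) (J : ℕ) (t : ℝ) (x : ℕ → EReal) (y : ℕ → ℝ) : Set ℕ :=
  {k | ∃ j ∈ Finset.range J, (∃ u ∈ Ioc (s j) (s (j + 1)), x k = (u : EReal)) ∧ t - s j < y k}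

lemma measurable_gridSet (s : ℕ → ℝ) (J : ℕ) (t : ℝ) :
    Measurable (fun p : (ℕ → EReal) × (ℕ → ℝ) => gridSet s J t p.1 p.2) := by
  rw [measurable_set_iff]
  intro k
  simp only [gridSet, mem_ofPred_eq, exists_mem_Ioc_coe_iff]
  rw [← measurableSet_setOfPred]
  have : {p : (ℕ → EReal) × (ℕ → ℝ) | ∃ j ∈ Finset.range J,
      ((s j : EReal) < p.1 k ∧ p.1 k ≤ s (j + 1)) ∧ t - s j < p.2 k} =
      ⋃ j ∈ Finset.range J, {p : (ℕ → EReal) × (ℕ → ℝ) |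
      ((s j : EReal) < p.1 k ∧ p.1 k ≤ s (j + 1)) ∧ t - s j < p.2 k} := by
    ext
    simp only [mem_ofPred_eq, mem_iUnion, exists_prop]
  rw [this]
  refine Finset.measurableSet_biUnion _ fun j _ => ?_
  have h1 : Measurable fun p : (ℕ → EReal) × (ℕ → ℝ) => p.1 k := by fun_prop
  have h2 : Measurable fun p : (ℕ → EReal) × (ℕ → ℝ) => p.2 k := by fun_prop
  exact ((measurableSet_lt measurable_const h1).inter
    (measurableSet_le h1 measurable_const)).inter (measurableSet_lt measurable_const h2)

lemma Monotone.eq_of_mem_Ioc {s : ℕ → ℝ} (hs : Monotone s) {i j : ℕ} {u : ℝ}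
    (hi : u ∈ Ioc (s i) (s (i + 1))) (hj : u ∈ Ioc (s j) (s (j + 1))) : i = j := by
  by_contra hne
  rcases lt_or_gt_of_ne hne with h | h
  · exact absurd (hi.2.trans (hs h)) (not_le.2 hj.1)
  · exact absurd (hj.2.trans (hs h)) (not_le.2 hi.1)

open Classical in
-- Disjoint cells make the count additive, so its generating function splits into one factor per
-- point. The finsets `K` encode that each cell holds finitely many points.
lemma pow_encard_gridSet {s : ℕ → ℝ} (hs : Monotone s) (J : ℕ) (t : ℝ) (x : ℕ → EReal)
    (y : ℕ → ℝ) (K : ℕ → Finset ℕ)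
    (hK : ∀ j ∈ Finset.range J, ∀ k, k ∈ K j ↔ ∃ u ∈ Ioc (s j) (s (j + 1)), x k = (u : EReal))
    (z : ℂ) :
    z ^ (gridSet s J t x y).encard.toNat =
      ∏ j ∈ Finset.range J, ∏ k ∈ K j, if t - s j < y k then z else 1 := by
  have hset : gridSet s J t x y =
      ((Finset.range J).biUnion fun j => (K j).filter fun k => t - s j < y k : Finset ℕ) := by
    ext k
    simp only [gridSet, mem_ofPred_eq, Finset.coe_biUnion, mem_iUnion, Finset.coe_filter]
    constructor
    · rintro ⟨j, hj, h1, h2⟩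
      exact ⟨j, hj, (hK j hj k).2 h1, h2⟩
    · rintro ⟨j, hj, h1, h2⟩
      exact ⟨j, hj, (hK j hj k).1 h1, h2⟩
  rw [hset, Set.encard_coe_eq_coe_finsetCard, ENat.toNat_natCast, Finset.card_biUnion,
    ← Finset.prod_pow_eq_pow_sum]
  · refine Finset.prod_congr rfl fun j _ => ?_
    rw [Finset.prod_ite, Finset.prod_const, Finset.prod_const_one, mul_one]
  · intro i hi j hj hij
    rw [Function.onFun, Finset.disjoint_left]
    intro k hki hkj
    obtain ⟨u, hu, hxu⟩ := (hK i hi k).1 (Finset.mem_filter.1 hki).1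
    obtain ⟨v, hv, hxv⟩ := (hK j hj k).1 (Finset.mem_filter.1 hkj).1
    obtain rfl : u = v := EReal.coe_injective (hxu.symm.trans hxv)
    exact hij (hs.eq_of_mem_Ioc hu hv)

lemma poissonLaw_singleton_top (r : ℝ≥0) : poissonLaw r {⊤} = 0 := by
  rw [poissonLaw, Measure.map_apply .of_discrete (measurableSet_singleton _)]
  convert measure_empty (μ := poissonMeasure r)
  ext n
  simp

lemma ProbabilityTheory.HasLaw.ae_ne_top_of_poissonLaw {N : Ω → ℕ∞} {r : ℝ≥0} (h : HasLaw N (poissonLaw r) P) :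
    ∀ᵐ ω ∂P, N ω ≠ ⊤ := by
  have h0 := poissonLaw_singleton_top r
  rw [← h.map_eq, Measure.map_apply_of_aemeasurable h.aemeasurable (measurableSet_singleton _)]
    at h0
  rw [ae_iff]
  convert h0 using 2
  ext ω
  simp

lemma integral_pow_poissonMeasure (r : ℝ≥0) (w : ℂ) :
    ∫ n, w ^ n ∂(poissonMeasure r) = Complex.exp (r * (w - 1)) := by
  rw [integral_poissonMeasure]
  have h : ∀ n : ℕ, (Real.exp (-r) * r ^ n / (n.factorial : ℝ)) • w ^ n =
      Complex.exp (-r) * ((r * w) ^ n / (n.factorial : ℂ)) := by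
    intro n
    rw [Complex.real_smul, mul_pow]
    push_cast
    ring
  simp_rw [h]
  rw [tsum_mul_left, (NormedSpace.expSeries_div_hasSum_exp ((r : ℂ) * w)).tsum_eq,
    ← Complex.exp_eq_exp_ℂ, ← Complex.exp_add]
  congr 1
  ring

variable [IsProbabilityMeasure P] {T : ℕ → Ω → EReal} {S : ℕ → Ω → ℝ} {rate : ℝ → ℝ≥0}

/-- Integrating over the marks first turns each point of cell `j` into a factor `1 + p j * (z - 1)`.
Independence of the cell counts and the Poisson generating function at that value then give the
exponential. -/
lemma integral_pow_encard_gridSet (hT : IsNHPoisson P T rate) (hSm : ∀ k, Measurable (S k))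
    (hS : iIndepFun S P) (hid : ∀ k, IdentDistrib (S k) (S 0) P P)
    (hTS : IndepFun (fun ω k => T k ω) (fun ω k => S k ω) P)
    {s : ℕ → ℝ} (hs : Monotone s) (J : ℕ) (t : ℝ) {z : ℂ} (hz : ‖z‖ ≤ 1) :
    ∫ ω, z ^ (gridSet s J t (fun k => T k ω) (fun k => S k ω)).encard.toNat ∂P =
      Complex.exp (((∑ j ∈ Finset.range J, (∫⁻ u in Ioc (s j) (s (j + 1)), rate u).toNNReal *
        (P {ω | t - s j < S 0 ω}).toNNReal : ℝ≥0) : ℂ) * (z - 1)) := by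
  classical
  set p : ℕ → ℝ≥0 := fun j => (P {ω | t - s j < S 0 ω}).toNNReal with hp
  set Λ : ℕ → ℝ≥0 := fun j => (∫⁻ u in Ioc (s j) (s (j + 1)), (rate u : ℝ≥0∞)).toNNReal with hΛ
  have hTm : Measurable (fun ω k => T k ω) := measurable_pi_iff.2 hT.measurable_point
  have hSm' : Measurable (fun ω k => S k ω) := measurable_pi_iff.2 hSm
  have hlaw : ∀ j, HasLaw (pointCount T (Ioc (s j) (s (j + 1)))) (poissonLaw (Λ j)) P :=
    fun j => hT.count_law _ _ (hs j.le_succ)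
  have hφ : ∀ j k, ∫ ω, (if t - s j < S k ω then z else 1) ∂P = 1 + p j * (z - 1) := by
    intro j k
    have hmeas : MeasurableSet {ω | t - s j < S k ω} := measurableSet_lt measurable_const (hSm k)
    have e : ∀ ω, (if t - s j < S k ω then z else 1) =
        1 + {ω | t - s j < S k ω}.indicator (fun _ => z - 1) ω := by
      intro ω
      by_cases h : t - s j < S k ω
      · rw [if_pos h, indicator_of_mem (by exact h)]; ring
      · rw [if_neg h, indicator_of_notMem (by exact h)]; ring
    simp_rw [e]
    rw [integral_add (integrable_const _) ((integrable_const _).indicator hmeas),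
      integral_indicator_const _ hmeas]
    have hPk : P {ω | t - s j < S k ω} = P {ω | t - s j < S 0 ω} :=
      (hid k).measure_mem_eq measurableSet_Ioi
    rw [measureReal_def, hPk, integral_const, Complex.real_smul]
    simp [hp]
    left
    rfl
  -- Inner integral with frozen arrivals; almost surely every cell is finite, so the product over
  -- its points makes sense.
  have step : ∀ᵐ ω ∂P, ∫ ω', z ^ (gridSet s J t (fun k => T k ω) (fun k => S k ω')).encard.toNat ∂P
      = ∏ j ∈ Finset.range J,
        (1 + p j * (z - 1)) ^ (pointCount T (Ioc (s j) (s (j + 1))) ω).toNat := by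
    have hfin : ∀ᵐ ω ∂P, ∀ j, pointCount T (Ioc (s j) (s (j + 1))) ω ≠ ⊤ :=
      ae_all_iff.2 fun j => (hlaw j).ae_ne_top_of_poissonLaw
    filter_upwards [hfin] with ω hω
    have hf : ∀ j, {k : ℕ | ∃ u ∈ Ioc (s j) (s (j + 1)), T k ω = (u : EReal)}.Finite :=
      fun j => Set.encard_ne_top_iff.1 (hω j)
    set K : ℕ → Finset ℕ := fun j => (hf j).toFinset with hK
    have hmem : ∀ j k, k ∈ K j ↔ ∃ u ∈ Ioc (s j) (s (j + 1)), T k ω = (u : EReal) := by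
      intro j k
      simp [hK]
    simp_rw [pow_encard_gridSet hs J t (fun k => T k ω) _ K (fun j _ => hmem j) z]
    rw [iIndepFun.integral_prod_prod hSm hS (Finset.range J) K ?_
      (φ := fun j y => if t - s j < y then z else 1)]
    · refine Finset.prod_congr rfl fun j _ => ?_
      simp_rw [hφ]
      rw [Finset.prod_const, pointCount, (hf j).encard_eq_coe_toFinset_card, ENat.toNat_natCast]
    · intro j
      exact Measurable.ite (measurableSet_lt measurable_const measurable_id) measurable_const
        measurable_const
    · intro i _ j _ k hi hj
      obtain ⟨u, hu, hxu⟩ := (hmem i k).1 hi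
      obtain ⟨v, hv, hxv⟩ := (hmem j k).1 hj
      obtain rfl : u = v := EReal.coe_injective (hxu.symm.trans hxv)
      exact hs.eq_of_mem_Ioc hu hv
  have hcm : Measurable fun q : (ℕ → EReal) × (ℕ → ℝ) =>
      z ^ (gridSet s J t q.1 q.2).encard.toNat :=
    (Measurable.of_discrete (f := fun n : ℕ∞ => z ^ n.toNat)).comp
      (measurable_encard.comp (measurable_gridSet s J t))
  rw [IndepFun.integral_comp_prodMk hTm hSm' hTS hcm (C := 1)
    (fun q => by rw [norm_pow]; exact pow_le_one₀ (norm_nonneg _) hz), integral_congr_ae step]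
  have hind := (hT.indep_count s hs).precomp (g := fun j : Finset.range J => (j : ℕ))
    Subtype.val_injective
  have hprod := hind.integral_fun_prod_comp
    (f := fun (j : Finset.range J) (n : ℕ∞) => (1 + p j * (z - 1)) ^ n.toNat)
    (fun j => (hlaw j).aemeasurable) (fun j => .of_discrete)
  have hcoe (F : ℕ → ℂ) : ∏ j ∈ Finset.range J, F j = ∏ j : Finset.range J, F j :=
    (Finset.prod_coe_sort _ _).symm
  simp_rw [hcoe]
  refine hprod.trans ?_
  have hj : ∀ j, ∫ ω, (1 + p j * (z - 1)) ^ (pointCount T (Ioc (s j) (s (j + 1))) ω).toNat ∂P =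
      Complex.exp (Λ j * p j * (z - 1)) := by
    intro j
    have h := (hlaw j).toNat_poissonLaw
    rw [← integral_map (f := fun n : ℕ => (1 + p j * (z - 1)) ^ n) h.aemeasurable .of_discrete,
      h.map_eq, integral_pow_poissonMeasure]
    congr 1
    ring
  simp_rw [hj]
  rw [← hcoe (fun j => Complex.exp (Λ j * p j * (z - 1))), ← Complex.exp_sum, ← Finset.sum_mul]
  push_cast
  rfl

lemma measure_encard_gridSet_eq (hT : IsNHPoisson P T rate) (hSm : ∀ k, Measurable (S k))
    (hS : iIndepFun S P) (hid : ∀ k, IdentDistrib (S k) (S 0) P P)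
    (hTS : IndepFun (fun ω k => T k ω) (fun ω k => S k ω) P)
    {s : ℕ → ℝ} (hs : Monotone s) (J : ℕ) (t : ℝ) (i : ℕ) :
    P {ω | (gridSet s J t (fun k => T k ω) (fun k => S k ω)).encard = i} =
      poissonMeasure (∑ j ∈ Finset.range J, (∫⁻ u in Ioc (s j) (s (j + 1)), rate u).toNNReal *
        (P {ω | t - s j < S 0 ω}).toNNReal) {i} := by
  set r := ∑ j ∈ Finset.range J, (∫⁻ u in Ioc (s j) (s (j + 1)), (rate u : ℝ≥0∞)).toNNReal *
        (P {ω | t - s j < S 0 ω}).toNNReal with hr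
  set C : Ω → ℕ := fun ω => (gridSet s J t (fun k => T k ω) (fun k => S k ω)).encard.toNat with hC
  have hTm : Measurable (fun ω k => T k ω) := measurable_pi_iff.2 hT.measurable_point
  have hSm' : Measurable (fun ω k => S k ω) := measurable_pi_iff.2 hSm
  have hCm : Measurable C := (Measurable.of_discrete (f := ENat.toNat)).comp
    (measurable_encard.comp ((measurable_gridSet s J t).comp (hTm.prodMk hSm')))
  have hCm' : Measurable (fun ω => (C ω : ℝ)) :=
    (Measurable.of_discrete (f := fun n : ℕ => (n : ℝ))).comp hCm
  have := Measure.isProbabilityMeasure_map (μ := P) hCm'.aemeasurable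
  have hPo : IsProbabilityMeasure ((poissonMeasure r).map (Nat.cast : ℕ → ℝ)) :=
    Measure.isProbabilityMeasure_map .of_discrete
  -- At `z = exp (i * a)` the generating function is the characteristic function, which determines
  -- the law.
  have hlaw : P.map (fun ω => (C ω : ℝ)) = (poissonMeasure r).map (Nat.cast : ℕ → ℝ) := by
    refine Measure.ext_of_charFun ?_
    funext a
    rw [charFun_map_cast_poissonMeasure, charFun_apply, integral_map hCm'.aemeasurable
      (by fun_prop), ← integral_pow_encard_gridSet hT hSm hS hid hTS hs J t
      (Complex.norm_exp_ofReal_mul_I a).le]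
    refine integral_congr_ae (ae_of_all _ fun ω => ?_)
    simp only [Real.inner_apply]
    rw [← Complex.exp_nat_mul]
    congr 1
    push_cast
    ring
  -- `toNat` sends `⊤` to `0`, so statements about `C` transfer to the cardinality only where it is
  -- finite.
  have hfin : ∀ᵐ ω ∂P, (gridSet s J t (fun k => T k ω) (fun k => S k ω)).encard ≠ ⊤ := by
    have : ∀ᵐ ω ∂P, ∀ j, pointCount T (Ioc (s j) (s (j + 1))) ω ≠ ⊤ :=
      ae_all_iff.2 fun j => (hT.count_law _ _ (hs j.le_succ)).ae_ne_top_of_poissonLaw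
    filter_upwards [this] with ω hω
    rw [Set.encard_ne_top_iff]
    refine ((Finset.range J).finite_toSet.biUnion fun j _ =>
      Set.encard_ne_top_iff.1 (hω j)).subset ?_
    rintro k ⟨j, hj, h, _⟩
    exact mem_biUnion hj h
  have h1 : P {ω | (gridSet s J t (fun k => T k ω) (fun k => S k ω)).encard = i} =
      P ((fun ω => (C ω : ℝ)) ⁻¹' {(i : ℝ)}) := by
    refine measure_congr ?_
    filter_upwards [hfin] with ω hω
    refine propext ?_
    change (gridSet s J t (fun k => T k ω) (fun k => S k ω)).encard = i ↔ (C ω : ℝ) = i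
    rw [Nat.cast_inj, hC, ← ENat.natCast_inj, ENat.natCast_toNat hω]
  rw [h1, ← Measure.map_apply hCm' (measurableSet_singleton _), hlaw,
    Measure.map_apply .of_discrete (measurableSet_singleton _)]
  congr 1
  ext n
  simp

end MarkedPoints

/-! ### Refining the grid -/

section PoissonLimit

open Filter Topology

/-- The grid of mesh `1 / (n + 1)` that starts at `t - (n + 1)` and reaches `t` after `(n + 1) ^ 2`
steps. -/
noncomputable def grid (t : ℝ) (n j : ℕ) : ℝ := t - (n + 1) + j / (n + 1)

lemma grid_monotone (t : ℝ) (n : ℕ) : Monotone (grid t n) := by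
  intro i j h
  unfold grid
  gcongr

lemma grid_end (t : ℝ) (n : ℕ) : grid t n ((n + 1) ^ 2) = t := by
  unfold grid
  push_cast
  field_simp
  ring

lemma Monotone.exists_mem_Ioc {s : ℕ → ℝ} {J : ℕ} {u : ℝ} (hu : u ∈ Ioc (s 0) (s J)) :
    ∃ j ∈ Finset.range J, u ∈ Ioc (s j) (s (j + 1)) := by
  induction J with
  | zero => exact absurd hu.2 (not_le.2 hu.1)
  | succ J ih =>
    by_cases h : u ≤ s J
    · obtain ⟨j, hj, hju⟩ := ih ⟨hu.1, h⟩
      exact ⟨j, Finset.mem_range.2 ((Finset.mem_range.1 hj).trans J.lt_succ_self), hju⟩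
    · exact ⟨J, Finset.self_mem_range_succ J, not_le.1 h, hu.2⟩

/-- The left end of the cell precedes `u`, so the grid test is stricter than the true one: the grid
can only undercount. -/
lemma mem_Ioc_of_mem_grid_cell {t u τ : ℝ} {n : ℕ} (h : ∃ j ∈ Finset.range ((n + 1) ^ 2),
    u ∈ Ioc (grid t n j) (grid t n (j + 1)) ∧ t - grid t n j < τ) : u ∈ Ioc (t - τ) t := by
  obtain ⟨j, hj, hu, h⟩ := h
  refine ⟨by linarith [hu.1], hu.2.trans ?_⟩
  exact (grid_monotone t n (Finset.mem_range.1 hj)).trans_eq (grid_end t n)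

/-- Since `t - τ < u` is strict, there is slack. Once the mesh is below it, the left end of the cell
of `u` still lies beyond `t - τ`; the growing window takes care of early `u`. -/
lemma eventually_mem_grid_cell {t u τ : ℝ} (h : u ∈ Ioc (t - τ) t) :
    ∀ᶠ n : ℕ in atTop, ∃ j ∈ Finset.range ((n + 1) ^ 2),
      u ∈ Ioc (grid t n j) (grid t n (j + 1)) ∧ t - grid t n j < τ := by
  have h1 : ∀ᶠ n : ℕ in atTop, t - u < n := tendsto_natCast_atTop_atTop.eventually_gt_atTop _
  have h2 : ∀ᶠ n : ℕ in atTop, 1 / ((n : ℝ) + 1) < u - (t - τ) :=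
    tendsto_one_div_add_atTop_nhds_zero_nat.eventually_lt_const (by linarith [h.1])
  filter_upwards [h1, h2] with n hn1 hn2
  have h0 : grid t n 0 < u := by
    simp only [grid, Nat.cast_zero, zero_div]
    linarith
  obtain ⟨j, hj, hju⟩ := Monotone.exists_mem_Ioc (s := grid t n) (J := (n + 1) ^ 2)
    ⟨h0, h.2.trans_eq (grid_end t n).symm⟩
  refine ⟨j, hj, hju, ?_⟩
  have : grid t n (j + 1) = grid t n j + 1 / (n + 1) := by
    unfold grid
    push_cast
    ring
  linarith [hju.2]

lemma mem_gridSet_grid_iff {t : ℝ} {n : ℕ} {x : ℕ → EReal} {y : ℕ → ℝ} {k : ℕ} :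
    k ∈ gridSet (grid t n) ((n + 1) ^ 2) t x y ↔
      ∃ u : ℝ, x k = u ∧ ∃ j ∈ Finset.range ((n + 1) ^ 2),
        u ∈ Ioc (grid t n j) (grid t n (j + 1)) ∧ t - grid t n j < y k := by
  constructor
  · rintro ⟨j, hj, ⟨u, hu, hx⟩, h⟩
    exact ⟨u, hx, j, hj, hu, h⟩
  · rintro ⟨u, hx, j, hj, hu, h⟩
    exact ⟨j, hj, ⟨u, hu, hx⟩, h⟩

/-- If finite subsets of `A` are eventually caught by the subsets `As n`, then the cardinalities
converge. -/
lemma Set.eventually_encard_eq_iff {A : Set ℕ} {As : ℕ → Set ℕ} (hsub : ∀ n, As n ⊆ A)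
    (hev : ∀ k ∈ A, ∀ᶠ n in atTop, k ∈ As n) (i : ℕ) :
    ∀ᶠ n in atTop, (As n).encard = i ↔ A.encard = i := by
  have hfin : ∀ B : Set ℕ, B.Finite → B ⊆ A → ∀ᶠ n in atTop, B ⊆ As n := fun B hB hBA =>
    (hB.eventually_all (l := atTop) (p := fun k n => k ∈ As n)).2 fun k hk => hev k (hBA hk)
  by_cases hA : A.Finite
  · filter_upwards [hfin A hA subset_rfl] with n hn
    rw [(hsub n).antisymm hn]
  · have htop : A.encard = ⊤ := Set.encard_eq_top_iff.2 hA
    -- For infinite `A`, a subset with `i + 1` elements is eventually caught, so both sides of the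
    -- equivalence fail.
    obtain ⟨B, hBA, hB⟩ := Set.exists_subset_encard_eq (s := A) (k := ((i + 1 : ℕ) : ℕ∞))
      (by rw [htop]; exact le_top)
    filter_upwards [hfin B (Set.finite_of_encard_eq_coe hB) hBA] with n hn
    have h1 := Set.encard_le_encard hn
    rw [hB] at h1
    constructor
    · intro h
      rw [h] at h1
      exact absurd (ENat.natCast_le_natCast.1 h1) (by omega)
    · intro h
      rw [htop] at h
      exact absurd h.symm (ENat.natCast_ne_top i)

variable {Ω : Type*} [MeasurableSpace Ω] {P : Measure Ω} [IsProbabilityMeasure P]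
  {T : ℕ → Ω → EReal} {S : ℕ → Ω → ℝ} {rate : ℝ → ℝ≥0}

lemma lintegral_Ioc_ne_top (hr : LocallyIntegrable (fun u => (rate u : ℝ)) volume) (a b : ℝ) :
    ∫⁻ u in Ioc a b, (rate u : ℝ≥0∞) ≠ ∞ := by
  have h : IntegrableOn (fun u => (rate u : ℝ)) (Ioc a b) :=
    (hr.integrableOn_isCompact isCompact_Icc).mono_set Ioc_subset_Icc_self
  have := h.hasFiniteIntegral
  rw [hasFiniteIntegral_iff_enorm] at this
  simpa using this.ne

/-- The expected number of points whose marks cross `t`, computed on the grid, converges. -/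
lemma tendsto_sum_grid {G : Measure ℝ} [IsProbabilityMeasure G]
    (hr : LocallyIntegrable (fun u => (rate u : ℝ)) volume) (t : ℝ)
    (hm : ∫⁻ τ in Ioi (0 : ℝ), (∫⁻ u in Ioc (t - τ) t, (rate u : ℝ≥0∞)) ∂G ≠ ∞) :
    Tendsto (fun n : ℕ => ∑ j ∈ Finset.range ((n + 1) ^ 2),
      (∫⁻ u in Ioc (grid t n j) (grid t n (j + 1)), (rate u : ℝ≥0∞)).toNNReal *
        (G (Ioi (t - grid t n j))).toNNReal) atTop
      (𝓝 (∫⁻ τ in Ioi (0 : ℝ), (∫⁻ u in Ioc (t - τ) t, (rate u : ℝ≥0∞)) ∂G).toNNReal) := by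
  set ν : Measure ℝ := volume.withDensity fun u => (rate u : ℝ≥0∞) with hν
  have hνI : ∀ a b, ∫⁻ u in Ioc a b, (rate u : ℝ≥0∞) = ν (Ioc a b) := fun a b =>
    (withDensity_apply _ measurableSet_Ioc).symm
  have hνfin : ∀ a b, ν (Ioc a b) ≠ ∞ := fun a b => by
    rw [← hνI]; exact lintegral_Ioc_ne_top hr a b
  simp_rw [hνI] at hm ⊢
  -- For `τ ≤ 0` the interval is empty, so the restriction to positive durations can be dropped.
  have hfull : ∫⁻ τ in Ioi (0 : ℝ), ν (Ioc (t - τ) t) ∂G = ∫⁻ τ, ν (Ioc (t - τ) t) ∂G := by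
    rw [← lintegral_indicator measurableSet_Ioi]
    refine lintegral_congr fun τ => ?_
    by_cases hτ : 0 < τ
    · rw [indicator_of_mem (by exact hτ)]
    · rw [indicator_of_notMem (by exact hτ), Ioc_eq_empty (by linarith), measure_empty]
  rw [hfull] at hm ⊢
  -- `D n τ` collects the arrival epochs that the grid counts for a duration `τ`. Its `ν`-mass,
  -- integrated against `G`, is the discrete sum, and it is dominated by `ν (Ioc (t - τ) t)`,
  -- integrable by `hm`.
  set D : ℕ → ℝ → Set ℝ := fun n τ => {u | ∃ j ∈ Finset.range ((n + 1) ^ 2),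
      u ∈ Ioc (grid t n j) (grid t n (j + 1)) ∧ t - grid t n j < τ} with hD
  have hDU : ∀ n τ, D n τ = ⋃ j ∈ Finset.range ((n + 1) ^ 2),
      if t - grid t n j < τ then Ioc (grid t n j) (grid t n (j + 1)) else ∅ := by
    intro n τ
    ext u
    simp only [hD, mem_ofPred_eq, mem_iUnion, exists_prop]
    refine exists_congr fun j => and_congr_right fun _ => ?_
    split_ifs with h <;> simp [h]
  have hcell : ∀ n τ j, MeasurableSet
      (if t - grid t n j < τ then Ioc (grid t n j) (grid t n (j + 1)) else ∅) := by
    intro n τ j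
    split_ifs
    · exact measurableSet_Ioc
    · exact .empty
  have hDm : ∀ n τ, MeasurableSet (D n τ) := fun n τ => by
    rw [hDU]; exact Finset.measurableSet_biUnion _ fun j _ => hcell n τ j
  have hDν : ∀ n τ, ν (D n τ) = ∑ j ∈ Finset.range ((n + 1) ^ 2),
      (Ioi (t - grid t n j)).indicator (fun _ => ν (Ioc (grid t n j) (grid t n (j + 1)))) τ := by
    intro n τ
    rw [hDU, measure_biUnion_finset _ fun j _ => hcell n τ j]
    · refine Finset.sum_congr rfl fun j _ => ?_
      by_cases h : t - grid t n j < τ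
      · rw [if_pos h, indicator_of_mem (by exact h)]
      · rw [if_neg h, indicator_of_notMem (by exact h), measure_empty]
    · intro i _ j _ hij
      rw [Function.onFun, Set.disjoint_left]
      intro u hi hj
      split_ifs at hi hj
      · exact hij ((grid_monotone t n).eq_of_mem_Ioc hi hj)
      all_goals simp_all
  have hlim : Tendsto (fun n => ∫⁻ τ, ν (D n τ) ∂G) atTop (𝓝 (∫⁻ τ, ν (Ioc (t - τ) t) ∂G)) := by
    refine tendsto_lintegral_of_dominated_convergence (fun τ => ν (Ioc (t - τ) t)) ?_ ?_ hm ?_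
    · intro n
      simp_rw [hDν]
      exact Finset.measurable_fun_sum _ fun j _ => measurable_const.indicator measurableSet_Ioi
    · exact fun n => ae_of_all _ fun τ => measure_mono fun u hu => mem_Ioc_of_mem_grid_cell hu
    · refine ae_of_all _ fun τ => tendsto_measure_of_ae_tendsto_indicator atTop measurableSet_Ioc
        (fun n => hDm n τ) measurableSet_Ioc (hνfin (t - τ) t)
        (Eventually.of_forall fun n u hu => mem_Ioc_of_mem_grid_cell hu) (ae_of_all _ fun u => ?_)
      by_cases hu : u ∈ Ioc (t - τ) t
      · filter_upwards [eventually_mem_grid_cell hu] with n hn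
        exact ⟨fun _ => hu, fun _ => hn⟩
      · exact Eventually.of_forall fun n =>
          ⟨fun h => mem_Ioc_of_mem_grid_cell h, fun h => absurd h hu⟩
  have hval : ∀ n, (∫⁻ τ, ν (D n τ) ∂G).toNNReal = ∑ j ∈ Finset.range ((n + 1) ^ 2),
      (ν (Ioc (grid t n j) (grid t n (j + 1)))).toNNReal *
        (G (Ioi (t - grid t n j))).toNNReal := by
    intro n
    simp_rw [hDν]
    rw [lintegral_finsetSum _ fun j _ => measurable_const.indicator measurableSet_Ioi]
    simp_rw [lintegral_indicator_const measurableSet_Ioi]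
    rw [ENNReal.toNNReal_sum fun j _ => ENNReal.mul_ne_top (hνfin _ _) (measure_ne_top _ _)]
    exact Finset.sum_congr rfl fun j _ => ENNReal.toNNReal_mul
  simp_rw [← hval]
  exact (ENNReal.tendsto_toNNReal hm).comp hlim

/-- Both laws have total mass one, so agreement at all finite values also settles the mass at `⊤`.
-/
lemma hasLaw_poissonLaw_of_measure_eq {N : Ω → ℕ∞} (hN : AEMeasurable N P) {r : ℝ≥0}
    (h : ∀ i : ℕ, P {ω | N ω = i} = poissonMeasure r {i}) : HasLaw N (poissonLaw r) P := by
  refine ⟨hN, ?_⟩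
  have hP := Measure.isProbabilityMeasure_map (μ := P) hN
  have hL : IsProbabilityMeasure (poissonLaw r) :=
    Measure.isProbabilityMeasure_map (μ := poissonMeasure r) .of_discrete
  have hi : ∀ i : ℕ, P.map N {(i : ℕ∞)} = poissonLaw r {(i : ℕ∞)} := by
    intro i
    rw [Measure.map_apply_of_aemeasurable hN (measurableSet_singleton _), poissonLaw,
      Measure.map_apply .of_discrete (measurableSet_singleton _)]
    refine (h i).trans ?_
    congr 1
    ext n
    simp
  have hcompl : ({⊤} : Set ℕ∞) = (⋃ i : ℕ, {(i : ℕ∞)})ᶜ := by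
    ext n
    induction n with
    | top => simp
    | coe n => simp
  have hU : P.map N (⋃ i : ℕ, {(i : ℕ∞)}) = poissonLaw r (⋃ i : ℕ, {(i : ℕ∞)}) := by
    have hd : Pairwise (Function.onFun Disjoint fun i : ℕ => ({(i : ℕ∞)} : Set ℕ∞)) := by
      intro i j hij
      simpa [Function.onFun] using hij
    rw [measure_iUnion hd fun _ => measurableSet_singleton _,
      measure_iUnion hd fun _ => measurableSet_singleton _]
    simp_rw [hi]
  refine Measure.ext_of_singleton fun n => ?_
  induction n with
  | top => rw [hcompl, prob_compl_eq_one_sub .of_discrete, prob_compl_eq_one_sub .of_discrete, hU]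
  | coe i => exact hi i

lemma continuous_poissonMeasure_singleton (i : ℕ) :
    Continuous fun r : ℝ≥0 => poissonMeasure r {i} := by
  simp_rw [poissonMeasure_singleton]
  exact ENNReal.continuous_ofReal.comp (by fun_prop)

/-- Independent i.i.d. marking of a Poisson process: the number of points `T k ≤ t` with
`t < T k + S k` is Poisson distributed. -/
theorem hasLaw_encard_marked_points (hT : IsNHPoisson P T rate)
    (hr : LocallyIntegrable (fun u => (rate u : ℝ)) volume) (hSm : ∀ k, Measurable (S k))
    (hS : iIndepFun S P) (hid : ∀ k, IdentDistrib (S k) (S 0) P P)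
    (hTS : IndepFun (fun ω k => T k ω) (fun ω k => S k ω) P) (t : ℝ)
    (hm : ∫⁻ τ in Ioi (0 : ℝ), (∫⁻ u in Ioc (t - τ) t, (rate u : ℝ≥0∞)) ∂(P.map (S 0)) ≠ ∞)
    {A : Ω → Set ℕ} (hAm : Measurable A)
    (hA : ∀ ω k, k ∈ A ω ↔ ∃ u ∈ Ioc (t - S k ω) t, T k ω = (u : EReal)) :
    HasLaw (fun ω => (A ω).encard) (poissonLaw (∫⁻ τ in Ioi (0 : ℝ),
      (∫⁻ u in Ioc (t - τ) t, (rate u : ℝ≥0∞)) ∂(P.map (S 0))).toNNReal) P := by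
  have hTm : Measurable (fun ω k => T k ω) := measurable_pi_iff.2 hT.measurable_point
  have hSm' : Measurable (fun ω k => S k ω) := measurable_pi_iff.2 hSm
  have hG := Measure.isProbabilityMeasure_map (μ := P) (hSm 0).aemeasurable
  have hAc : Measurable fun ω => (A ω).encard := measurable_encard.comp hAm
  refine hasLaw_poissonLaw_of_measure_eq hAc.aemeasurable fun i => ?_
  -- For each `ω` the events "the count is `i`" stabilise, so their probabilities converge; no prior
  -- finiteness of `A ω` is needed.
  have h1 : Tendsto (fun n : ℕ => P {ω | (gridSet (grid t n) ((n + 1) ^ 2) t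
      (fun k => T k ω) (fun k => S k ω)).encard = i}) atTop (𝓝 (P {ω | (A ω).encard = i})) := by
    refine tendsto_measure_of_ae_tendsto_indicator_of_isFiniteMeasure atTop
      (hAc (measurableSet_singleton _)) (fun n => ?_) (ae_of_all _ fun ω => ?_)
    · exact (measurable_encard.comp ((measurable_gridSet (grid t n) ((n + 1) ^ 2) t).comp
        (hTm.prodMk hSm'))) (measurableSet_singleton (i : ℕ∞))
    · refine Set.eventually_encard_eq_iff (fun n k hk => ?_) (fun k hk => ?_) i
      · obtain ⟨u, hx, h⟩ := mem_gridSet_grid_iff.1 hk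
        exact (hA ω k).2 ⟨u, mem_Ioc_of_mem_grid_cell h, hx⟩
      · obtain ⟨u, hu, hx⟩ := (hA ω k).1 hk
        filter_upwards [eventually_mem_grid_cell hu] with n hn
        exact mem_gridSet_grid_iff.2 ⟨u, hx, hn⟩
  have h2 := ((continuous_poissonMeasure_singleton i).tendsto _).comp
    (tendsto_sum_grid (G := P.map (S 0)) hr t hm)
  refine tendsto_nhds_unique h1 (h2.congr fun n => ?_)
  rw [measure_encard_gridSet_eq hT hSm hS hid hTS (grid_monotone t n)]
  simp only [Function.comp_apply]
  congr 2
  refine Finset.sum_congr rfl fun j _ => ?_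
  rw [Measure.map_apply (hSm 0) measurableSet_Ioi]
  rfl

end PoissonLimit

/-! ### Enumerating a finite set first -/

section Enumeration

/-- The injection of `ℕ` that first enumerates `F` and then continues beyond its largest element. -/
def enumFirst (F : Finset ℕ) (j : ℕ) : ℕ :=
  if h : j < F.card then F.orderEmbOfFin rfl ⟨j, h⟩ else F.sup id + 1 + j

lemma enumFirst_injective (F : Finset ℕ) : Function.Injective (enumFirst F) := by
  have hle : ∀ i (h : i < F.card), F.orderEmbOfFin rfl ⟨i, h⟩ ≤ F.sup id := fun i h =>
    Finset.le_sup (f := id) (F.orderEmbOfFin_mem rfl ⟨i, h⟩)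
  intro i j h
  unfold enumFirst at h
  split_ifs at h with h1 h2 h2
  · simpa using (F.orderEmbOfFin rfl).injective h
  · have := hle i h1
    omega
  · have := hle j h2
    omega
  · omega

lemma sum_range_enumFirst (F : Finset ℕ) (b : ℕ → ℝ) :
    ∑ j ∈ Finset.range F.card, b (enumFirst F j) = ∑ k ∈ F, b k := by
  rw [Finset.sum_range]
  have h : ∀ j : Fin F.card, enumFirst F j = F.orderEmbOfFin rfl j := fun j => by
    simp [enumFirst]
  simp_rw [h]
  conv_rhs => rw [← Finset.image_orderEmbOfFin_univ F rfl]
  rw [Finset.sum_image fun i _ j _ hij => (F.orderEmbOfFin rfl).injective hij]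

open Classical in
/-- A finite set as a `Finset`; infinite sets are sent to `∅`. -/
noncomputable def Set.finsetOrEmpty (A : Set ℕ) : Finset ℕ :=
  if h : A.Finite then h.toFinset else ∅

lemma Set.coe_finsetOrEmpty {A : Set ℕ} (h : A.Finite) : (A.finsetOrEmpty : Set ℕ) = A := by
  simp [Set.finsetOrEmpty, h]

lemma Set.measurable_finsetOrEmpty : Measurable Set.finsetOrEmpty := by
  rw [measurable_finset_iff]
  intro a
  rw [← measurableSet_setOfPred]
  have : {A : Set ℕ | a ∈ A.finsetOrEmpty} = {A : Set ℕ | A.Finite} ∩ {A : Set ℕ | a ∈ A} := by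
    ext A
    by_cases h : A.Finite <;> simp [Set.finsetOrEmpty, h]
  rw [this]
  exact MeasurableSet.setOfPred_finite.inter (measurableSet_mem a)

end Enumeration

/-! ### The service system: batch requirements, busy count, utilization -/

namespace InfCapSystem

variable {Ω : Type*} [MeasurableSpace Ω] {P : Measure Ω} {I R : Type*}

/-- The indices of points `x k` with service time `y k` that are in service at time `t`. -/
def inServiceSet (t : ℝ) (x : ℕ → EReal) (y : ℕ → ℝ) : Set ℕ :=
  {k | ∃ u ∈ Ioc (t - y k) t, x k = (u : EReal)}

lemma measurable_inServiceSet (t : ℝ) :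
    Measurable (fun p : (ℕ → EReal) × (ℕ → ℝ) => inServiceSet t p.1 p.2) := by
  rw [measurable_set_iff]
  intro k
  simp only [inServiceSet, mem_ofPred_eq, exists_mem_Ioc_coe_iff]
  rw [← measurableSet_setOfPred]
  have h1 : Measurable fun p : (ℕ → EReal) × (ℕ → ℝ) => p.1 k := by fun_prop
  have h2 : Measurable fun p : (ℕ → EReal) × (ℕ → ℝ) => ((t - p.2 k : ℝ) : EReal) :=
    measurable_coe_real_ereal.comp (by fun_prop)
  exact (measurableSet_lt h2 h1).inter (measurableSet_le h1 measurable_const)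

/-- The infinite values drop out: `⊤ ≤ t` fails, and `⊥` plus a real duration is still `⊥`, so such
a batch is never in service. -/
lemma inService_iff (Q : InfCapSystem P I R) (i : I) (t : ℝ) (k : ℕ) (ω : Ω) :
    Q.InService i t k ω ↔
      k ∈ inServiceSet t (fun k => Q.arrival i k ω) (fun k => Q.service i k ω) := by
  unfold InService inServiceSet
  simp only [mem_ofPred_eq]
  induction Q.arrival i k ω with
  | bot => simp
  | top => simp
  | coe u =>
    rw [← EReal.coe_add, EReal.coe_lt_coe_iff, EReal.coe_le_coe_iff]
    constructor
    · rintro ⟨h1, h2⟩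
      exact ⟨u, ⟨by linarith, h1⟩, rfl⟩
    · rintro ⟨v, ⟨h1, h2⟩, h⟩
      obtain rfl := EReal.coe_injective h
      exact ⟨h2, by linarith⟩

lemma setOf_inService (Q : InfCapSystem P I R) (i : I) (t : ℝ) (ω : Ω) :
    {k | Q.InService i t k ω} =
      inServiceSet t (fun k => Q.arrival i k ω) (fun k => Q.service i k ω) :=
  Set.ext fun k => Q.inService_iff i t k ω

lemma measurable_arrival (Q : InfCapSystem P I R) (i : I) :
    Measurable fun ω k => Q.arrival i k ω :=
  measurable_pi_iff.2 (Q.arrival_poisson i).measurable_point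

lemma measurable_service (Q : InfCapSystem P I R) (i : I) :
    Measurable fun ω k => Q.service i k ω :=
  measurable_pi_iff.2 (Q.service_measurable i)

lemma measurable_size (Q : InfCapSystem P I R) (i : I) : Measurable fun ω k => Q.size i k ω :=
  measurable_pi_iff.2 (Q.size_measurable i)

lemma measurable_req (Q : InfCapSystem P I R) (i : I) (n : R) :
    Measurable fun ω k l => Q.req i n k l ω :=
  measurable_pi_iff.2 fun k => measurable_pi_iff.2 fun l => Q.req_measurable i n k l

lemma measurable_batchReq (Q : InfCapSystem P I R) (i : I) (n : R) (k : ℕ) :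
    Measurable (Q.batchReq i n k) :=
  measurable_sum_range_prod.comp
    ((Q.size_measurable i k).prodMk (measurable_pi_iff.2 (Q.req_measurable i n k)))

lemma iIndepFun_req (Q : InfCapSystem P I R) (i : I) (n : R) (k : ℕ) :
    iIndepFun (Q.req i n k) P :=
  (Q.req_iIndep i n).precomp (g := fun l => (k, l)) fun _ _ h => (Prod.mk.inj h).2

lemma iIndepFun_size_req (Q : InfCapSystem P I R) (i : I) (n : R) :
    iIndepFun (fun k ω => (Q.size i k ω, fun l => Q.req i n k l ω)) P := by
  -- Passing from independent entries to independent rows: the product measure over `ℕ × ℕ` curries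
  -- to a product of products.
  have hreq : iIndepFun (fun k ω l => Q.req i n k l ω) P := by
    have hP := (Q.req_iIndep i n).isProbabilityMeasure
    have hp : ∀ k l, IsProbabilityMeasure (P.map (Q.req i n k l)) := fun k l =>
      Measure.isProbabilityMeasure_map (Q.req_measurable i n k l).aemeasurable
    have hm : ∀ kl : ℕ × ℕ, Measurable (Q.req i n kl.1 kl.2) := fun kl =>
      Q.req_measurable i n kl.1 kl.2
    have hrow : ∀ k, P.map (fun ω l => Q.req i n k l ω) =
        Measure.infinitePi fun l => P.map (Q.req i n k l) := fun k =>
      (Q.iIndepFun_req i n k).map_fun_eq_infinitePi_map (Q.req_measurable i n k)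
    rw [iIndepFun_iff_map_fun_eq_infinitePi_map fun k =>
      measurable_pi_iff.2 (Q.req_measurable i n k)]
    simp_rw [hrow]
    rw [← Measure.infinitePi_map_curry (fun k l => P.map (Q.req i n k l)),
      ← (Q.req_iIndep i n).map_fun_eq_infinitePi_map hm,
      Measure.map_map (by fun_prop) (measurable_pi_iff.2 hm)]
    rfl
  exact iIndepFun_prodMk (Q.size_measurable i)
    (fun k => measurable_pi_iff.2 (Q.req_measurable i n k)) (Q.size_iIndep i) hreq
    (Q.size_indep i n)

lemma iIndepFun_batchReq (Q : InfCapSystem P I R) (i : I) (n : R) :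
    iIndepFun (Q.batchReq i n) P :=
  (Q.iIndepFun_size_req i n).comp (fun _ p => ∑ l ∈ Finset.range p.1, p.2 l)
    fun _ => measurable_sum_range_prod

lemma indepFun_size_req (Q : InfCapSystem P I R) (i : I) (n : R) (k : ℕ) :
    IndepFun (Q.size i k) (fun ω l => Q.req i n k l ω) P :=
  (Q.size_indep i n).comp (measurable_pi_apply k) (measurable_pi_apply k)

lemma measurable_setOf_inService (Q : InfCapSystem P I R) (i : I) (t : ℝ) :
    Measurable fun ω => {k | Q.InService i t k ω} := by
  simp_rw [setOf_inService]
  exact (measurable_inServiceSet t).comp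
    ((Q.measurable_arrival i).prodMk (Q.measurable_service i))

lemma measurable_busy (Q : InfCapSystem P I R) (i : I) (t : ℝ) : Measurable (Q.busy i t) :=
  measurable_encard.comp (Q.measurable_setOf_inService i t)

lemma utilization_eq_sum (Q : InfCapSystem P I R) (i : I) (n : R) (t : ℝ) (ω : Ω) {F : Finset ℕ}
    (hF : (F : Set ℕ) = {k | Q.InService i t k ω}) :
    Q.utilization i n t ω = ∑ k ∈ F, Q.batchReq i n k ω := by
  have hmem : ∀ k, k ∈ F ↔ Q.InService i t k ω := fun k => by
    rw [← Finset.mem_coe, hF]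
    rfl
  unfold utilization
  rw [tsum_eq_sum (s := F) fun k hk => if_neg fun h => hk ((hmem k).2 h)]
  exact Finset.sum_congr rfl fun k hk => if_pos ((hmem k).1 hk)

variable [IsProbabilityMeasure P]

/-- A batch requirement is one fixed function of the size and the row of requirements, whose joint
law is a product not depending on `k`. -/
lemma identDistrib_batchReq (Q : InfCapSystem P I R) (i : I) (n : R) (k : ℕ) :
    IdentDistrib (Q.batchReq i n k) (Q.batchReq i n 0) P P := by
  have hm : ∀ k, Measurable fun ω l => Q.req i n k l ω := fun k =>
    measurable_pi_iff.2 (Q.req_measurable i n k)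
  have hlaw : ∀ k, P.map (fun ω l => Q.req i n k l ω) =
      Measure.infinitePi fun _ : ℕ => P.map (Q.req i n 0 0) := by
    intro k
    rw [(Q.iIndepFun_req i n k).map_fun_eq_infinitePi_map (Q.req_measurable i n k)]
    congr 1
    funext l
    exact (Q.req_ident i n k l).map_eq
  have hpair : IdentDistrib (fun ω => (Q.size i k ω, fun l => Q.req i n k l ω))
      (fun ω => (Q.size i 0 ω, fun l => Q.req i n 0 l ω)) P P := by
    refine ⟨((Q.size_measurable i k).prodMk (hm k)).aemeasurable,
      ((Q.size_measurable i 0).prodMk (hm 0)).aemeasurable, ?_⟩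
    rw [(indepFun_iff_map_prod_eq_prod_map_map (Q.size_measurable i k).aemeasurable
        (hm k).aemeasurable).1 (Q.indepFun_size_req i n k),
      (indepFun_iff_map_prod_eq_prod_map_map (Q.size_measurable i 0).aemeasurable
        (hm 0).aemeasurable).1 (Q.indepFun_size_req i n 0), hlaw, hlaw, (Q.size_ident i k).map_eq]
  exact hpair.comp measurable_sum_range_prod

lemma indepFun_arrival_service_batchReq (Q : InfCapSystem P I R) (i : I) (n : R) :
    IndepFun (fun ω => ((fun k => Q.arrival i k ω), fun k => Q.service i k ω))
      (fun ω k => Q.batchReq i n k ω) P := by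
  have h := IndepFun.prodMk_left_of_right (Q.measurable_arrival i) (Q.measurable_service i)
    ((Q.measurable_size i).prodMk (Q.measurable_req i n)) (Q.arrival_indep i n)
    (Q.service_indep i n)
  have hφ : Measurable fun (p : (ℕ → ℕ) × (ℕ → ℕ → ℝ)) (k : ℕ) =>
      ∑ l ∈ Finset.range (p.1 k), p.2 k l := by
    refine measurable_pi_iff.2 fun k => measurable_sum_range_prod.comp
      (g := fun p : ℕ × (ℕ → ℝ) => ∑ l ∈ Finset.range p.1, p.2 l)
      (f := fun p : (ℕ → ℕ) × (ℕ → ℕ → ℝ) => (p.1 k, p.2 k)) ?_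
    fun_prop
  exact h.comp measurable_id hφ

lemma batchReq_moments (Q : InfCapSystem P I R) (i : I) (n : R) :
    MemLp (Q.batchReq i n 0) 2 P ∧
    ∫ ω, Q.batchReq i n 0 ω ∂P = Q.sizeMean i * Q.reqMean i n ∧
    variance (Q.batchReq i n 0) P =
      Q.sizeMean i * Q.reqSD i n ^ 2 + Q.sizeSD i ^ 2 * Q.reqMean i n ^ 2 := by
  obtain ⟨h1, h2, h3⟩ := memLp_and_moments_random_sum (Q.size_measurable i 0)
    (Q.req_measurable i n 0) (Q.iIndepFun_req i n 0) (fun l => Q.req_ident i n 0 l)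
    (Q.req_memLp i n) (Q.indepFun_size_req i n 0) (Q.size_memLp i)
  refine ⟨h1, h2, h3.trans ?_⟩
  rw [reqSD, sizeSD, Real.sq_sqrt (variance_nonneg _ _), Real.sq_sqrt (variance_nonneg _ _)]
  rfl

/-- The resource `n` enters because independence of arrivals and durations is read off from
`arrival_indep`, which is stated per resource. -/
lemma hasLaw_busy (Q : InfCapSystem P I R) (i : I) {t : ℝ} (ht : Q.offeredMean i t ≠ ∞)
    (n : R) : HasLaw (Q.busy i t) (poissonLaw (Q.offeredMean i t).toNNReal) P := by
  refine hasLaw_encard_marked_points (Q.arrival_poisson i) (Q.rate_locInt i)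
    (Q.service_measurable i) (Q.service_iIndep i) (Q.service_ident i) ?_ t ht
    (A := fun ω => {k | Q.InService i t k ω}) ?_ fun ω k => Q.inService_iff i t k ω
  · exact (Q.arrival_indep i n).comp measurable_id measurable_fst
  · exact Q.measurable_setOf_inService i t

lemma ae_finite_inService (Q : InfCapSystem P I R) (i : I) {t : ℝ}
    (ht : Q.offeredMean i t ≠ ∞) (n : R) : ∀ᵐ ω ∂P, {k | Q.InService i t k ω}.Finite := by
  filter_upwards [(Q.hasLaw_busy i ht n).ae_ne_top_of_poissonLaw] with ω hω
  exact Set.encard_ne_top_iff.1 hω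

/-- The utilization is a random sum over an i.i.d. sequence: list the batches in service first. -/
lemma exists_compound_representation (Q : InfCapSystem P I R) (i : I) (n : R) {t : ℝ}
    (ht : Q.offeredMean i t ≠ ∞) :
    ∃ B : ℕ → Ω → ℝ, (∀ k, Measurable (B k)) ∧ iIndepFun B P ∧
      (∀ k, HasLaw (B k) (P.map (Q.batchReq i n 0)) P) ∧
      IndepFun (Q.busy i t) (fun ω k => B k ω) P ∧
      ∀ᵐ ω ∂P, Q.utilization i n t ω = ∑ k ∈ Finset.range (Q.busy i t ω).toNat, B k ω := by
  -- The label is the set in service as a `Finset`: a countable label space, as relabelling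
  -- requires, and a function of arrivals and durations alone.
  set g : (ℕ → EReal) × (ℕ → ℝ) → Finset ℕ := fun p => (inServiceSet t p.1 p.2).finsetOrEmpty
  have hg : Measurable g := Set.measurable_finsetOrEmpty.comp (measurable_inServiceSet t)
  set F : Ω → Finset ℕ := fun ω => g (fun k => Q.arrival i k ω, fun k => Q.service i k ω) with hF
  have hFm : Measurable F := hg.comp ((Q.measurable_arrival i).prodMk (Q.measurable_service i))
  have hFB : IndepFun F (fun ω k => Q.batchReq i n k ω) P :=
    (Q.indepFun_arrival_service_batchReq i n).comp hg measurable_id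
  obtain ⟨h1, h2, h3, h4⟩ := indepFun_randomInjection enumFirst_injective hFm
    (Q.measurable_batchReq i n) (Q.iIndepFun_batchReq i n) (Q.identDistrib_batchReq i n) hFB
  have hFA : ∀ᵐ ω ∂P, (F ω : Set ℕ) = {k | Q.InService i t k ω} := by
    filter_upwards [Q.ae_finite_inService i ht n] with ω hω
    rw [setOf_inService] at hω ⊢
    exact Set.coe_finsetOrEmpty hω
  have hcard : ∀ᵐ ω ∂P, ((F ω).card : ℕ∞) = Q.busy i t ω := by
    filter_upwards [hFA] with ω hω
    rw [busy, ← hω, Set.encard_coe_eq_coe_finsetCard]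
  refine ⟨_, measurable_pi_iff.1 h1, h2, h3, ?_, ?_⟩
  · exact (h4.comp (Measurable.of_discrete (f := fun F : Finset ℕ => (F.card : ℕ∞)))
      measurable_id).congr hcard (ae_of_all _ fun _ => rfl)
  · filter_upwards [hFA, hcard] with ω hω hc
    rw [Q.utilization_eq_sum i n t ω hω, ← hc, ENat.toNat_natCast]
    exact (sum_range_enumFirst (F ω) fun k => Q.batchReq i n k ω).symm

end InfCapSystem

/-! ### The stochastic offered load lemma -/

theorem lemma1 {Ω : Type*} [MeasurableSpace Ω] (P : Measure Ω) [IsProbabilityMeasure P]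
    {I R : Type*} (Q : InfCapSystem P I R) (i : I) (n : R) :
    -- the batch requirements are i.i.d. and independent of the arrival and service times, and
    -- the utilization process is at each time their sum over the finitely many batches in service
    (iIndepFun (Q.batchReq i n) P ∧
      (∀ k, IdentDistrib (Q.batchReq i n k) (Q.batchReq i n 0) P P) ∧
      IndepFun (fun ω => ((fun k => Q.arrival i k ω), fun k => Q.service i k ω))
        (fun ω k => Q.batchReq i n k ω) P ∧
      ∀ t, Q.offeredMean i t ≠ ∞ → ∀ᵐ ω ∂P, {k : ℕ | Q.InService i t k ω}.Finite ∧
        Q.utilization i n t ω = ∑ᶠ k ∈ {k : ℕ | Q.InService i t k ω}, Q.batchReq i n k ω) ∧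
    -- at each time the utilization is compound Poisson, with the stated moments
    ∀ t : ℝ, Q.offeredMean i t ≠ ∞ →
      IsCompoundPoisson P (Q.busy i t) (Q.utilization i n t) (Q.offeredMean i t).toNNReal
        (P.map (Q.batchReq i n 0)) ∧
      MemLp (Q.utilization i n t) 2 P ∧
      ∫ ω, Q.utilization i n t ω ∂P
        = Q.sizeMean i * Q.reqMean i n * (Q.offeredMean i t).toReal ∧
      variance (Q.utilization i n t) P
        = (Q.offeredMean i t).toReal *
          (Q.reqSD i n ^ 2 * Q.sizeMean i + Q.reqMean i n ^ 2 * Q.sizeSD i ^ 2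
            + Q.sizeMean i ^ 2 * Q.reqMean i n ^ 2) := by
  have hB := Q.identDistrib_batchReq i n
  refine ⟨⟨Q.iIndepFun_batchReq i n, hB, Q.indepFun_arrival_service_batchReq i n, ?_⟩, ?_⟩
  · intro t ht
    filter_upwards [Q.ae_finite_inService i ht n] with ω hω
    refine ⟨hω, ?_⟩
    exact (Q.utilization_eq_sum i n t ω (F := hω.toFinset) hω.coe_toFinset).trans
      (finsum_mem_eq_finite_toFinset_sum _ hω).symm
  · intro t ht
    obtain ⟨B, hBm, hBi, hBlaw, hNB, hX⟩ := Q.exists_compound_representation i n ht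
    have hN := Q.hasLaw_busy i ht n
    refine ⟨⟨hN, B, hBi, hBlaw, hNB, hX⟩, ?_⟩
    have hN' := hN.toNat_poissonLaw
    obtain ⟨hN2, hNmean, hNvar⟩ := hN'.poisson_moments
    obtain ⟨hb2, hbmean, hbvar⟩ := Q.batchReq_moments i n
    have hB0 : IdentDistrib (B 0) (Q.batchReq i n 0) P P :=
      ⟨(hBm 0).aemeasurable, (Q.measurable_batchReq i n 0).aemeasurable, (hBlaw 0).map_eq⟩
    have hNm : Measurable fun ω => (Q.busy i t ω).toNat :=
      (Measurable.of_discrete (f := ENat.toNat)).comp (Q.measurable_busy i t)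
    -- Wald over the batches in service: as mean and variance of the count agree, the variance is `m
    -- * (Var B + (E B) ^ 2)`.
    obtain ⟨h1, h2, h3⟩ := memLp_and_moments_random_sum hNm hBm hBi
      (fun k => ⟨(hBm k).aemeasurable, (hBm 0).aemeasurable,
        (hBlaw k).map_eq.trans (hBlaw 0).map_eq.symm⟩) (hB0.memLp_iff.2 hb2)
      (hNB.comp (Measurable.of_discrete (f := ENat.toNat)) measurable_id) hN2
    rw [hNmean, hB0.integral_eq, hbmean] at h2
    rw [hNmean, hNvar, hB0.variance_eq, hB0.integral_eq, hbmean, hbvar] at h3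
    refine ⟨(memLp_congr_ae hX).2 h1, ?_, ?_⟩
    · rw [integral_congr_ae hX, h2, ENNReal.coe_toNNReal_eq_toReal]
      ring
    · rw [variance_congr hX, h3, ENNReal.coe_toNNReal_eq_toReal]
      ring
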